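/- Let $V$ be a real normed vector space of finite dimension $n\ge 1$ with closed unit ball $B$, and let $\Omega$ be a non-zero volume form on $V$. For a $k$-dimensional normed space $W$ with unit ball $B_W$, let $\mu_W$ be a norm on the line $\Lambda^k W$, regarded as a Lebesgue measure on $W$. The Busemann volume $\mu^b$ is determined by $\mu^b_W(B_W)=\omega_k$, and the Holmes--Thompson volume $\mu^{ht}$ by $\mu^{ht}_W(B_W)=\frac{1}{\omega_k}\operatorname{vp}(B_W)$, where $\omega_k$ is the volume of the Euclidean unit ball of $\mathbb{R}^k$ and $\operatorname{vp}(B_W)$ is the symplectic volume of $B_W\times B_W^\circ\subset W\times W^*$. A star body is a compact set that is star-shaped with respect to the origin, has the origin in its interior, and has continuous radial function $\rho$ on $V\setminus\{0\}$; it is smooth if $\rho$ is $C^\infty$ on $V\setminus\{0\}$. For a smooth star body $S$, put $$\tilde A_\mu(S)=\int_{\partial S}\tilde\mu_{n-1},$$ where $\tilde\mu_{n-1}$ is at $p\in\partial S$ the density $\mu_{V/\langle p\rangle}$ on $T_p\partial S\cong V/\langle p\rangle$, and $V/\langle p\rangle$ carries the quotient norm. The dual mixed volume is $$\tilde V(S_1,\dots,S_n)=\frac1n\int_\Sigma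 \rho_{S_1}\cdots\rho_{S_n}\,i_v\Omega ,$$ with $\Sigma$ a sphere around the origin. A dual isoperimetrix for $\mu$ (with respect to $\Omega$) is a star body $T\subset V$ such that $$\tilde A_\mu(S)=n\,\tilde V(S,\dots,S,T)\qquad\text{for all smooth star bodies } S\subset V .$$ The projection body $\Pi K\subset V^*$ of a convex body $K\subset V$ is the convex body with support function $h(\Pi K,v)=\operatorname{vol}(\pi_vK,i_v\Omega)$ for $v\neq0$, where $\pi_v:V\to V/\langle v\rangle$ is the projection; $\Pi^\circ K=(\Pi K)^\circ\subset V^{**}= V$. The intersection body $IS\subset V^*$ of a star body $S\subset V$ is the star body with radial function $\rho(IS,\xi)=\operatorname{vol}(S\cap\ker\xi,\Omega_\xi)$ for $\xi\neq0$, where $\Omega=\xi\wedge\Omega_\xi$. The body $I(B^\circ)\subset V^{**}=V$ is formed with respect to the volume form on $V^*$ dual to $\Omega$. Then the set $\omega_{n-1}\Pi^\circ(B)$ is a dual isoperimetrix for $\mu^b$, the set $\frac{1}{\omega_{n-1}}I(B^\circ)$ is a dual isoperimetrix for $\mu^{ht}$, and if $n\ge2$ these are the only ones: $$\tilde{\mathbb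 I}_{\mu^b}(B)=\omega_{n-1}\Pi^\circ(B),\qquad \tilde{\mathbb I}_{\mu^{ht}}(B)=\frac1{\omega_{n-1}}I(B^\circ).$$ -/

import Mathlib

open MeasureTheory Module
open scoped ENNReal Pointwise

noncomputable section

namespace DualIso

universe u

/-! ### Lebesgue volumes on real vector spaces -/

/-- `ω_k`, the volume of the Euclidean unit ball of `ℝ^k` (so `ω_0 = 1`). -/
def ballVol (k : ℕ) : ℝ :=
  (volume (Metric.closedBall (0 : EuclideanSpace ℝ (Fin k)) 1)).toReal

/-- If `b` is a basis of `W`: the Lebesgue volume of `A`, normalized such that the parallelotope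
spanned by `b` has volume `1`. -/
def coordVol {W ι : Type*} [AddCommGroup W] [Module ℝ W] [Fintype ι]
    (b : ι → W) (A : Set W) : ℝ :=
  (volume {x : ι → ℝ | ∑ i, x i • b i ∈ A}).toReal

open Classical in
/-- `vol(A, θ)`: the volume of `A` with respect to a volume form `θ` on a `k`-dimensional space `W`.
Here `b` is any `k`-tuple with `θ b ≠ 0`, hence a basis; the value does not depend on it. -/
def formVol {W : Type*} [AddCommGroup W] [Module ℝ W] {k : ℕ}
    (θ : W [⋀^Fin k]→ₗ[ℝ] ℝ) (A : Set W) : ℝ :=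
  if h : ∃ b, θ b ≠ 0 then |θ h.choose| * coordVol h.choose A else 0

/-! ### Volume forms on quotients, on hyperplanes and on the dual space -/

section Forms

variable {V : Type*} [AddCommGroup V] [Module ℝ V]

theorem exists_section (v : V) :
    ∃ s : (V ⧸ Submodule.span ℝ {v}) →ₗ[ℝ] V,
      (Submodule.span ℝ {v}).mkQ ∘ₗ s = LinearMap.id :=
  (Submodule.span ℝ {v}).mkQ.exists_rightInverse_of_surjective (Submodule.range_mkQ _)

/-- The form `i_v Ω = Ω(v, ·)` on the quotient `V / ⟨v⟩`, see `contraction_mk`. -/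
def contraction {m : ℕ} (Ω : V [⋀^Fin (m + 1)]→ₗ[ℝ] ℝ) (v : V) :
    (V ⧸ Submodule.span ℝ {v}) [⋀^Fin m]→ₗ[ℝ] ℝ :=
  (Ω.curryLeft v).compLinearMap (exists_section v).choose

open Classical in
/-- For `ξ ≠ 0`, the restriction to `ker ξ` of any `Ω_ξ` with `Ω = ξ ∧ Ω_ξ`; it equals `Ω(w, ·)` for
any `w` with `ξ w = 1`, see `restrictedForm_eq`. -/
def restrictedForm {m : ℕ} (Ω : V [⋀^Fin (m + 1)]→ₗ[ℝ] ℝ) (ξ : Dual ℝ V) :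
    (LinearMap.ker ξ) [⋀^Fin m]→ₗ[ℝ] ℝ :=
  if h : ∃ w, ξ w = 1 then (Ω.curryLeft h.choose).compLinearMap (LinearMap.ker ξ).subtype else 0

open Classical in
/-- The volume form on `V*` dual to the volume form `Ω` on the `k`-dimensional space `V`:
`(ξ_1, …, ξ_k) ↦ det (ξ_i (b_j)) / Ω(b_1, …, b_k)`, for any basis `b` of `V`. -/
def dualForm {k : ℕ} (Ω : V [⋀^Fin k]→ₗ[ℝ] ℝ) : (Dual ℝ V) [⋀^Fin k]→ₗ[ℝ] ℝ :=
  if h : ∃ b, Ω b ≠ 0 then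
    (Ω h.choose)⁻¹ • (Matrix.detRowAlternating (R := ℝ) (n := Fin k)).compLinearMap
      (LinearMap.pi fun j => Dual.eval ℝ V (h.choose j))
  else 0

/-! ### Polar, projection and intersection bodies -/

/-- `K° ⊆ V*`. -/
def polarBody (K : Set V) : Set (Dual ℝ V) := {ξ | ∀ x ∈ K, ξ x ≤ 1}

/-- `ΠK ⊆ V*`: the convex body with support function `h(ΠK, v) = vol(π_v K, i_v Ω)`, `v ≠ 0`,
where `π_v : V → V / ⟨v⟩` is the projection. -/
def projectionBody {m : ℕ} (Ω : V [⋀^Fin (m + 1)]→ₗ[ℝ] ℝ) (K : Set V) : Set (Dual ℝ V) :=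
  {ξ | ∀ v : V, v ≠ 0 →
    ξ v ≤ formVol (contraction Ω v) ((Submodule.span ℝ {v}).mkQ '' K)}

/-- `Π°K ⊆ V`: the polar `(ΠK)° ⊆ V**`, with `V**` identified with `V`. -/
def polarProjectionBody {m : ℕ} (Ω : V [⋀^Fin (m + 1)]→ₗ[ℝ] ℝ) (K : Set V) : Set V :=
  Dual.eval ℝ V ⁻¹' polarBody (projectionBody Ω K)

/-- `IS ⊆ V*`: the star body with radial function `ρ(IS, ξ) = vol(S ∩ ker ξ, Ω_ξ)`, `ξ ≠ 0`. -/
def intersectionBody {m : ℕ} (Ω : V [⋀^Fin (m + 1)]→ₗ[ℝ] ℝ) (S : Set V) : Set (Dual ℝ V) :=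
  {ξ | ξ = 0 ∨ 1 ≤ formVol (restrictedForm Ω ξ) {x : LinearMap.ker ξ | (x : V) ∈ S}}

/-- `I(K°) ⊆ V`: the intersection body of `K° ⊆ V*`, formed with the dual volume form on `V*`,
with `V**` identified with `V`. -/
def intersectionBodyOfPolar {m : ℕ} (Ω : V [⋀^Fin (m + 1)]→ₗ[ℝ] ℝ) (K : Set V) : Set V :=
  Dual.eval ℝ V ⁻¹' intersectionBody (dualForm Ω) (polarBody K)

theorem contraction_mk {m : ℕ} (Ω : V [⋀^Fin (m + 1)]→ₗ[ℝ] ℝ) (v : V) (x : Fin m → V) :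
    contraction Ω v (fun i => (Submodule.span ℝ {v}).mkQ (x i)) = Ω (Matrix.vecCons v x) := by
  have hs : ∀ q, (Submodule.span ℝ {v}).mkQ ((exists_section v).choose q) = q := fun q =>
    LinearMap.congr_fun (exists_section v).choose_spec q
  have key : ∀ y z : Fin m → V,
      (∀ i, (Submodule.span ℝ {v}).mkQ (y i) = (Submodule.span ℝ {v}).mkQ (z i)) →
      Ω (Matrix.vecCons v y) = Ω (Matrix.vecCons v z) := by
    intro y z hyz
    have hc : ∀ i, ∃ c : ℝ, y i = z i + c • v := by
      intro i
      obtain ⟨c, hc⟩ := Submodule.mem_span_singleton.1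
        ((Submodule.Quotient.eq (Submodule.span ℝ {v})).1 (hyz i))
      exact ⟨c, by rw [hc]; abel⟩
    choose c hc using hc
    have hstep : ∀ t : Finset (Fin m),
        Ω (Matrix.vecCons v fun i => if i ∈ t then y i else z i) = Ω (Matrix.vecCons v z) := by
      intro t
      induction t using Finset.induction_on with
      | empty => simp
      | insert a t ha ih =>
        rw [← ih]
        have e : (Matrix.vecCons v fun i => if i ∈ insert a t then y i else z i) =
            Function.update (Matrix.vecCons v fun i => if i ∈ t then y i else z i) a.succ
              ((Matrix.vecCons v fun i => if i ∈ t then y i else z i) a.succ +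
                c a • (Matrix.vecCons v fun i => if i ∈ t then y i else z i) 0) := by
          funext j
          refine Fin.cases ?_ (fun i => ?_) j
          · simp [Function.update_of_ne (Fin.succ_ne_zero a).symm]
          · by_cases hi : i = a
            · subst hi
              simp [ha, hc i]
            · simp [hi]
        rw [e]
        rw [Ω.map_update_add, Ω.map_update_smul, Ω.map_update_self _ (Fin.succ_ne_zero a),
          Function.update_eq_self, smul_zero, add_zero]
    simpa using hstep Finset.univ
  exact key _ _ fun i => hs _

theorem restrictedForm_eq {m : ℕ} (Ω : V [⋀^Fin (m + 1)]→ₗ[ℝ] ℝ) (ξ : Dual ℝ V) (hξ : ξ ≠ 0)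
    (η : V [⋀^Fin m]→ₗ[ℝ] ℝ)
    (h : Ω = AlternatingMap.alternatizeUncurryFin (LinearMap.smulRight ξ η)) :
    restrictedForm Ω ξ = η.compLinearMap (LinearMap.ker ξ).subtype := by
  have hw : ∃ w, ξ w = 1 := by
    obtain ⟨x, hx⟩ : ∃ x, ξ x ≠ 0 := by
      by_contra hx
      push Not at hx
      exact hξ (LinearMap.ext hx)
    exact ⟨(ξ x)⁻¹ • x, by simp [hx]⟩
  rw [restrictedForm, dif_pos hw]
  ext x
  have h0 : ∀ i, ξ (x i : V) = 0 := fun i => (x i).2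
  have h1 : ξ hw.choose = 1 := hw.choose_spec
  have hrem : Fin.removeNth 0 (Matrix.vecCons hw.choose fun i => (x i : V)) =
      fun i => (x i : V) := by
    funext i
    simp [Fin.removeNth]
  have e : Ω (Matrix.vecCons hw.choose fun i => (x i : V)) = η fun i => (x i : V) := by
    rw [h, AlternatingMap.alternatizeUncurryFin_apply, Fin.sum_univ_succ]
    simp [h0, h1, hrem]
  exact e

end Forms

/-! ### Definitions of volume -/

/-- An assignment to each finite-dimensional normed space `W` of a function on tuples of vectors. On tuples of length
`k = dim W` its value at `(w_1, …, w_k)` stands for `μ_W(w_1 ∧ … ∧ w_k)`, where `μ_W` is a norm on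
the line `Λ^k W`. -/
def VolumeAssignment : Type (u + 1) :=
  ∀ (W : Type u) [NormedAddCommGroup W] [NormedSpace ℝ W] [FiniteDimensional ℝ W]
    {k : ℕ}, (Fin k → W) → ℝ

open Classical in
/-- The norm on `Λ^k W`, `k = dim W`, for which the unit ball `B` of `W` has total volume
`∫_B μ = c`, evaluated at `w_1 ∧ … ∧ w_k`. -/
def normWithBallVolume (c : ℝ) {W : Type u} [NormedAddCommGroup W] [NormedSpace ℝ W] {k : ℕ}
    (w : Fin k → W) : ℝ :=
  if LinearIndependent ℝ w then c / coordVol w (Metric.closedBall (0 : W) 1) else 0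

/-- The volume product of the unit ball `B` of `W`, i.e. the symplectic volume of
`B × B° ⊆ W × W*`, computed in a basis and its dual basis. -/
def volumeProduct (W : Type u) [NormedAddCommGroup W] [NormedSpace ℝ W]
    [FiniteDimensional ℝ W] : ℝ :=
  coordVol (finBasis ℝ W) (Metric.closedBall (0 : W) 1) *
    coordVol (finBasis ℝ W).dualBasis (polarBody (Metric.closedBall (0 : W) 1))

/-- Busemann volume: unit balls of dimension `k` have volume `ω_k`. -/
def busemann : VolumeAssignment.{u} := fun W _ _ _ _ w =>
  normWithBallVolume (ballVol (finrank ℝ W)) w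

/-- Holmes–Thompson volume: unit balls of dimension `k` have volume `ω_k⁻¹ vp(B)`. -/
def holmesThompson : VolumeAssignment.{u} := fun W _ _ _ _ w =>
  normWithBallVolume (volumeProduct W / ballVol (finrank ℝ W)) w

/-! ### Star bodies and dual mixed volumes -/

section Star

variable {V : Type u} [NormedAddCommGroup V] [NormedSpace ℝ V]

def radialFunction (S : Set V) (x : V) : ℝ := sSup {t : ℝ | 0 ≤ t ∧ t • x ∈ S}

structure IsStarBody (S : Set V) : Prop where
  isCompact : IsCompact S
  starConvex : StarConvex ℝ 0 S
  zero_mem_interior : (0 : V) ∈ interior S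
  continuousOn : ContinuousOn (radialFunction S) {0}ᶜ

structure IsSmoothStarBody (S : Set V) : Prop extends IsStarBody S where
  contDiffOn : ContDiffOn ℝ (⊤ : ℕ∞) (radialFunction S) {0}ᶜ

open Classical in
/-- The dual mixed volume `(1/k) ∫ ρ_{S_1} ⋯ ρ_{S_k} i_v Ω` of `S_1, …, S_k ⊆ V`, `k = dim V`, the
integral being over the Euclidean unit sphere in linear coordinates given by a basis `b`; on that
sphere `|i_v Ω|` is `|Ω(b)|` times the surface measure. The value does not depend on `b`. -/
def dualMixedVolume {k : ℕ} (Ω : V [⋀^Fin k]→ₗ[ℝ] ℝ) (S : Fin k → Set V) : ℝ :=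
  if h : ∃ b, Ω b ≠ 0 then
    |Ω h.choose| / k *
      ∫ x : Metric.sphere (0 : EuclideanSpace ℝ (Fin k)) 1,
        ∏ i, radialFunction (S i) (∑ j, (x : EuclideanSpace ℝ (Fin k)) j • h.choose j)
          ∂(volume : Measure (EuclideanSpace ℝ (Fin k))).toSphere
  else 0

/-! ### Integration of densities and the dual surface area -/

/-- `φ` restricted to the open set `U ⊆ ℝ^m` is a smooth local parametrization of `M`. -/
structure IsParametrization {m : ℕ} (M : Set V) (φ : (Fin m → ℝ) → V) (U : Set (Fin m → ℝ)) :
    Prop where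
  isOpen : IsOpen U
  contDiffOn : ContDiffOn ℝ (⊤ : ℕ∞) φ U
  injOn : Set.InjOn φ U
  mapsTo : Set.MapsTo φ U M
  immersion : ∀ x ∈ U, Function.Injective (fderiv ℝ φ x)

/-- `∫_M δ` for a nonnegative `m`-density `δ` (with `δ p v` its value at `v_1 ∧ … ∧ v_m` in `T_p M`)
on an `m`-dimensional submanifold `M` of `V`: the supremum, over all finite families of local
parametrizations `φ_j : U_j → M` and measurable `A_j ⊆ U_j` with pairwise disjoint images
`φ_j(A_j)`, of `∑_j ∫_{A_j} δ(∂_1 φ_j ∧ … ∧ ∂_m φ_j) dx`. -/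
def densityIntegral {m : ℕ} (M : Set V) (δ : V → (Fin m → V) → ℝ) : ℝ≥0∞ :=
  ⨆ (N : ℕ) (φ : Fin N → (Fin m → ℝ) → V) (U : Fin N → Set (Fin m → ℝ))
    (A : Fin N → Set (Fin m → ℝ))
    (_ : ∀ j, IsParametrization M (φ j) (U j))
    (_ : ∀ j, A j ⊆ U j ∧ MeasurableSet (A j))
    (_ : Pairwise fun j j' => Disjoint (φ j '' A j) (φ j' '' A j')),
    ∑ j, ∫⁻ x in A j,
      ENNReal.ofReal (δ (φ j x) fun i => fderiv ℝ (φ j) x (Pi.single i 1))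

/-- Lines are closed, so that `V / ⟨p⟩` carries its quotient norm. -/
instance isClosed_line (p : V) : IsClosed (Submodule.span ℝ {p} : Set V) :=
  Submodule.closed_of_finiteDimensional _

/-- The density `v_1 ∧ … ∧ v_m ↦ μ_{V/⟨p⟩}(v_1 ∧ … ∧ v_m)`, where `V/⟨p⟩` has the quotient norm. -/
def quotientDensity [FiniteDimensional ℝ V] (μ : VolumeAssignment.{u}) {m : ℕ} (p : V) (v : Fin m → V) : ℝ :=
  μ (V ⧸ Submodule.span ℝ {p}) fun i => (Submodule.span ℝ {p}).mkQ (v i)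

/-- The dual surface area of a smooth star body `S` in a space of dimension `m + 1`. -/
def dualSurfaceArea [FiniteDimensional ℝ V] (μ : VolumeAssignment.{u}) (m : ℕ) (S : Set V) : ℝ≥0∞ :=
  densityIntegral (m := m) (frontier S) (quotientDensity μ)

/-- `T` is a dual isoperimetrix of `V`, `dim V = m + 1`, with respect to `μ` and `Ω`: a star body
with `Ã_μ(S) = (m + 1) Ṽ(S, …, S, T)` for all smooth star bodies `S`. -/
def IsDualIsoperimetrix [FiniteDimensional ℝ V] (μ : VolumeAssignment.{u}) {m : ℕ}
    (Ω : V [⋀^Fin (m + 1)]→ₗ[ℝ] ℝ)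
    (T : Set V) : Prop :=
  IsStarBody T ∧ ∀ S : Set V, IsSmoothStarBody S →
    dualSurfaceArea μ m S =
      ENNReal.ofReal ((m + 1 : ℝ) *
        dualMixedVolume Ω (Fin.snoc (α := fun _ => Set V) (fun _ : Fin m => S) T))

end Star

end DualIso

end

noncomputable section

namespace DualIso

open MeasureTheory Module
open scoped ENNReal Pointwise

/-! ### Volumes in coordinates -/

section CoordVol

variable {W ι : Type*} [AddCommGroup W] [Module ℝ W] [Fintype ι]

/-! Write n = m + 1. Both assertions follow from one principle about a positive function g on V \
{0} that is continuous and homogeneous of degree -1 (`IsRadial`). Suppose the density of μ on V/⟨p⟩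
is g(p)|Ω(p, ·)|. Then the body with radial function g is a dual isoperimetrix, and for m ≥ 1 it is
the only one.

To see this, cone off a piece of ∂S by (t, x) ↦ tφ(x). The Jacobian of this map is t^m Ω(φ, ∂φ) up
to the constant Ω(b), and g/ρ_S is constant along rays. So the integral of the density over the
piece is |Ω(b)|(m + 1) times the integral of g/ρ_S over its cone (`setLIntegral_chart`). The cones
fill the set ρ_S > 1 up to a null set (`dualSurfaceArea_eq_lintegral`), and polar coordinates turn
the total into the spherical integral of ρ_S^m g (`setLIntegral_radial`). This is nṼ(S, …, S, T)
exactly when T has radial function g. For uniqueness, choose S with ρ_S^m = 1 + ψ on the Euclidean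
sphere, ψ ≥ 0 smooth and otherwise arbitrary. The integrals against ψ then determine ρ_T
(`IsDualIsoperimetrix.eq_starSet`).

It remains to find g. Normalizing by the unit ball of V/⟨p⟩, which is the projection of B, gives a
constant divided by h(p), where h = `shadow Ω` is the volume of that projection. For Busemann volume
g = ω_m/h. That 1/h is the radial function of Π°B requires h to be the support function of ΠB. This
holds because h is sublinear (`shadow_add_le`), so by Hahn–Banach each value h(x) is attained by a
functional in ΠB (`polarProjectionBody_closedBall`). For Holmes–Thompson volume, the dual of V/⟨p⟩
is p^⊥ and its unit ball is B° ∩ p^⊥. The volume of the projection of B cancels from the volume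
product, leaving the volume of that section, which is the radial function of I(B°)
(`volumeProduct_quotient`). -/

theorem exists_basis_coe_eq [FiniteDimensional ℝ W] {c : ι → W}
    (hc : LinearIndependent ℝ c) (h : Fintype.card ι = finrank ℝ W) :
    ∃ b : Basis ι ℝ W, ⇑b = c :=
  ⟨Basis.mk hc (hc.span_eq_top_of_card_eq_finrank' h).ge, Basis.coe_mk _ _⟩

/-- The matrix `b.toMatrix c` sends `c`-coordinates to `b`-coordinates, so it maps one coordinate
set onto the other and scales Lebesgue measure by its determinant. -/
theorem volume_coord_change [DecidableEq ι] (b c : Basis ι ℝ W) (A : Set W) :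
    volume {x : ι → ℝ | ∑ i, x i • b i ∈ A} =
      ENNReal.ofReal |b.det c| * volume {x : ι → ℝ | ∑ i, x i • c i ∈ A} := by
  have hdet : LinearMap.det (Matrix.toLin' (b.toMatrix c)) = b.det c := by
    rw [LinearMap.det_toLin', Basis.det_apply]
  rw [← hdet, ← Measure.addHaar_image_linearMap]
  congr 1
  have key : ∀ x : ι → ℝ,
      ∑ i, (Matrix.toLin' (b.toMatrix c) x) i • b i = ∑ i, x i • c i := by
    intro x
    have : ∀ j, c j = ∑ i, b.toMatrix c i j • b i := fun j => (b.sum_toMatrix_smul_self c j).symm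
    simp only [Matrix.toLin'_apply, Matrix.mulVec, dotProduct, Finset.sum_smul]
    rw [Finset.sum_comm]
    refine Finset.sum_congr rfl fun j _ => ?_
    rw [this j, Finset.smul_sum]
    exact Finset.sum_congr rfl fun i _ => by rw [smul_smul, mul_comm]
  ext y
  constructor
  · intro hy
    refine ⟨Matrix.toLin' (c.toMatrix b) y, ?_, ?_⟩
    · have h2 : Matrix.toLin' (b.toMatrix c) (Matrix.toLin' (c.toMatrix b) y) = y := by
        rw [← LinearMap.comp_apply, ← Matrix.toLin'_mul, Basis.toMatrix_mul_toMatrix_flip,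
          Matrix.toLin'_one, LinearMap.id_apply]
      have := key (Matrix.toLin' (c.toMatrix b) y)
      rw [h2] at this
      simpa only [Set.mem_ofPred_eq, ← this] using hy
    · rw [← LinearMap.comp_apply, ← Matrix.toLin'_mul, Basis.toMatrix_mul_toMatrix_flip,
          Matrix.toLin'_one, LinearMap.id_apply]
  · rintro ⟨x, hx, rfl⟩
    simpa only [Set.mem_ofPred_eq, key] using hx

theorem coordVol_change [DecidableEq ι] (b c : Basis ι ℝ W) (A : Set W) :
    coordVol b A = |b.det c| * coordVol c A := by
  rw [coordVol, volume_coord_change b c, ENNReal.toReal_mul,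
    ENNReal.toReal_ofReal (abs_nonneg _), coordVol]

theorem volume_coord_smul (b : ι → W) (A : Set W) {r : ℝ} (hr : 0 < r) :
    volume {x : ι → ℝ | ∑ i, x i • b i ∈ r • A} =
      ENNReal.ofReal (r ^ Fintype.card ι) * volume {x : ι → ℝ | ∑ i, x i • b i ∈ A} := by
  have : {x : ι → ℝ | ∑ i, x i • b i ∈ r • A} = r • {x : ι → ℝ | ∑ i, x i • b i ∈ A} := by
    ext x
    rw [Set.mem_smul_set_iff_inv_smul_mem₀ hr.ne', Set.mem_ofPred_eq, Set.mem_ofPred_eq,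
      Set.mem_smul_set_iff_inv_smul_mem₀ hr.ne', Finset.smul_sum]
    simp [smul_smul]
  rw [this, Measure.addHaar_smul, abs_of_pos (pow_pos hr _), finrank_fintype_fun_eq_card]

theorem coordVol_smul (b : ι → W) (A : Set W) {r : ℝ} (hr : 0 < r) :
    coordVol b (r • A) = r ^ Fintype.card ι * coordVol b A := by
  rw [coordVol, volume_coord_smul b A hr, ENNReal.toReal_mul,
    ENNReal.toReal_ofReal (pow_pos hr _).le, coordVol]

theorem exists_basis_of_apply_ne_zero {k : ℕ} (hk : finrank ℝ W = k) [FiniteDimensional ℝ W]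
    {θ : W [⋀^Fin k]→ₗ[ℝ] ℝ} {c : Fin k → W} (h : θ c ≠ 0) :
    ∃ b : Basis (Fin k) ℝ W, ⇑b = c := by
  refine exists_basis_coe_eq ?_ (by simp [hk])
  by_contra hc
  exact h (θ.map_linearDependent c hc)

/-- This frees `formVol` from its arbitrarily chosen tuple: the factor `b.det c` gained by the
coordinate volume is the one by which `θ` changes from `b` to `c`. -/
theorem formVol_eq {k : ℕ} [FiniteDimensional ℝ W] (θ : W [⋀^Fin k]→ₗ[ℝ] ℝ)
    (c : Basis (Fin k) ℝ W) (A : Set W) : formVol θ A = |θ c| * coordVol c A := by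
  have hk : finrank ℝ W = k := by simpa using finrank_eq_card_basis c
  unfold formVol
  split_ifs with h
  · obtain ⟨b, hb⟩ := exists_basis_of_apply_ne_zero hk h.choose_spec
    rw [← hb, coordVol_change b c, ← mul_assoc, ← abs_mul]
    have := congrArg (fun f => f c) (θ.eq_smul_basis_det b)
    simp only [AlternatingMap.smul_apply, smul_eq_mul] at this
    rw [← this]
  · push Not at h
    simp [h c]

theorem apply_basis_ne_zero {k : ℕ} {θ : W [⋀^Fin k]→ₗ[ℝ] ℝ} (hθ : θ ≠ 0)
    (c : Basis (Fin k) ℝ W) : θ c ≠ 0 := by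
  intro h
  apply hθ
  rw [θ.eq_smul_basis_det c, h, zero_smul]

end CoordVol

/-! ### Finiteness and positivity of coordinate volumes -/

section Normed

variable {W ι : Type*} [NormedAddCommGroup W] [NormedSpace ℝ W] [Fintype ι]

theorem exists_norm_le_mul_norm_sum {b : ι → W} (hb : LinearIndependent ℝ b) :
    ∃ C : ℝ, 0 < C ∧ ∀ x : ι → ℝ, ‖x‖ ≤ C * ‖∑ i, x i • b i‖ := by
  let f : (ι → ℝ) →ₗ[ℝ] W := Fintype.linearCombination ℝ b
  have hf : LinearMap.ker f = ⊥ := LinearMap.ker_eq_bot.2 hb.fintypeLinearCombination_injective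
  obtain ⟨K, hK, h⟩ := f.exists_antilipschitzWith hf
  refine ⟨K, by exact_mod_cast hK, fun x => ?_⟩
  have := h.le_mul_norm_sub x 0
  simpa [f, Fintype.linearCombination_apply] using this

theorem continuous_coord_sum (b : ι → W) : Continuous fun x : ι → ℝ => ∑ i, x i • b i := by
  fun_prop

theorem volume_coord_lt_top {b : ι → W} (hb : LinearIndependent ℝ b) {A : Set W}
    (hA : Bornology.IsBounded A) : volume {x : ι → ℝ | ∑ i, x i • b i ∈ A} < ∞ := by
  obtain ⟨C, hC, h⟩ := exists_norm_le_mul_norm_sum hb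
  obtain ⟨R, hR⟩ := hA.exists_norm_le
  refine Bornology.IsBounded.measure_lt_top ?_
  refine (isBounded_iff_forall_norm_le).2 ⟨C * R, fun x hx => (h x).trans ?_⟩
  exact mul_le_mul_of_nonneg_left (hR _ hx) hC.le

theorem coordVol_mono {b : ι → W} (hb : LinearIndependent ℝ b) {A A' : Set W}
    (hA : Bornology.IsBounded A') (h : A ⊆ A') : coordVol b A ≤ coordVol b A' :=
  ENNReal.toReal_mono (volume_coord_lt_top hb hA).ne (measure_mono fun _ hx => h hx)

theorem coordVol_pos {b : ι → W} (hb : LinearIndependent ℝ b) {A : Set W}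
    (hA : Bornology.IsBounded A) (h0 : A ∈ nhds 0) : 0 < coordVol b A := by
  refine ENNReal.toReal_pos ?_ (volume_coord_lt_top hb hA).ne
  refine (Measure.measure_pos_of_mem_nhds volume (x := (0 : ι → ℝ)) ?_).ne'
  exact (continuous_coord_sum b).continuousAt.preimage_mem_nhds (by simpa using h0)

theorem coordVol_closedBall_pos {b : ι → W} (hb : LinearIndependent ℝ b) :
    0 < coordVol b (Metric.closedBall (0 : W) 1) :=
  coordVol_pos hb Metric.isBounded_closedBall (Metric.closedBall_mem_nhds _ one_pos)

end Normed

theorem ballVol_pos (k : ℕ) : 0 < ballVol k :=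
  ENNReal.toReal_pos (Metric.measure_closedBall_pos _ _ one_pos).ne' measure_closedBall_lt_top.ne

/-! ### Bases adapted to a line -/

section Line

variable {V : Type*} [AddCommGroup V] [Module ℝ V] [FiniteDimensional ℝ V] {m : ℕ}

theorem finrank_quotient_line (hV : finrank ℝ V = m + 1) {v : V} (hv : v ≠ 0) :
    finrank ℝ (V ⧸ Submodule.span ℝ {v}) = m := by
  have := Submodule.finrank_quotient_add_finrank (Submodule.span ℝ {v})
  rw [finrank_span_singleton hv, hV] at this
  omega

theorem exists_basis_zero_eq (hV : finrank ℝ V = m + 1) {v : V} (hv : v ≠ 0) :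
    ∃ c : Basis (Fin (m + 1)) ℝ V, c 0 = v := by
  obtain ⟨s, hs⟩ := exists_section v
  let q := finBasisOfFinrankEq ℝ _ (finrank_quotient_line hV hv)
  have hli : LinearIndependent ℝ (Fin.cons v (s ∘ q) : Fin (m + 1) → V) := by
    rw [Fintype.linearIndependent_iff]
    intro g hg
    rw [Fin.sum_univ_succ] at hg
    have h1 := congrArg (Submodule.span ℝ {v}).mkQ hg
    have hs' : ∀ x, (Submodule.span ℝ {v}).mkQ (s x) = x := fun x => LinearMap.congr_fun hs x
    have hv0 : (Submodule.span ℝ {v}).mkQ v = 0 := by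
      simp [Submodule.mem_span_singleton_self]
    simp only [Fin.cons_zero, Fin.cons_succ, map_add, map_smul, map_sum, Function.comp, hs', hv0,
      smul_zero, zero_add, map_zero] at h1
    have h2 := Fintype.linearIndependent_iff.1 q.linearIndependent _ h1
    simp only [h2, zero_smul, Finset.sum_const_zero, add_zero, Fin.cons_zero] at hg
    intro i
    refine Fin.cases ?_ h2 i
    exact (smul_eq_zero.1 hg).resolve_right hv
  obtain ⟨c, hc⟩ := exists_basis_coe_eq hli (by simp [hV])
  exact ⟨c, by rw [hc, Fin.cons_zero]⟩

/-- The contraction of Ω by v is a nonzero top-degree form on V/⟨v⟩, hence vanishes exactly on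
dependent tuples. -/
theorem linearIndependent_mkQ_iff (hV : finrank ℝ V = m + 1) {Ω : V [⋀^Fin (m + 1)]→ₗ[ℝ] ℝ}
    (hΩ : Ω ≠ 0) {v : V} (hv : v ≠ 0) (x : Fin m → V) :
    LinearIndependent ℝ (fun i => (Submodule.span ℝ {v}).mkQ (x i)) ↔
      Ω (Matrix.vecCons v x) ≠ 0 := by
  rw [← contraction_mk]
  constructor
  · intro hx
    obtain ⟨q, hq⟩ := exists_basis_coe_eq hx (by simp [finrank_quotient_line hV hv])
    rw [← hq]
    refine apply_basis_ne_zero ?_ q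
    intro h0
    obtain ⟨c, hc⟩ := exists_basis_zero_eq hV hv
    have := contraction_mk Ω v (fun i => c i.succ)
    rw [h0, AlternatingMap.zero_apply, ← hc] at this
    refine apply_basis_ne_zero hΩ c ?_
    rw [this]
    congr 1
    funext j
    refine Fin.cases ?_ (fun i => ?_) j <;> simp
  · intro h
    by_contra hx
    exact h (AlternatingMap.map_linearDependent _ _ hx)

omit [FiniteDimensional ℝ V] in
theorem basis_eq_vecCons {v : V} (c : Basis (Fin (m + 1)) ℝ V) (hc : c 0 = v) :
    (c : Fin (m + 1) → V) = Matrix.vecCons v fun i => c i.succ := by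
  funext j
  refine Fin.cases ?_ (fun i => ?_) j <;> simp [hc]

theorem formVol_contraction (hV : finrank ℝ V = m + 1) {Ω : V [⋀^Fin (m + 1)]→ₗ[ℝ] ℝ}
    (hΩ : Ω ≠ 0) {v : V} (hv : v ≠ 0) {x : Fin m → V} (hx : Ω (Matrix.vecCons v x) ≠ 0)
    (A : Set (V ⧸ Submodule.span ℝ {v})) :
    formVol (contraction Ω v) A =
      |Ω (Matrix.vecCons v x)| * coordVol (fun i => (Submodule.span ℝ {v}).mkQ (x i)) A := by
  obtain ⟨q, hq⟩ := exists_basis_coe_eq ((linearIndependent_mkQ_iff hV hΩ hv x).2 hx)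
    (by simp [finrank_quotient_line hV hv])
  rw [formVol_eq _ q, hq, contraction_mk]

end Line

/-! ### Star bodies and radial functions -/

section Star

variable {V : Type*} [NormedAddCommGroup V] [NormedSpace ℝ V]

/-- The properties of the radial function of a star body, off the origin. -/
structure IsRadial (g : V → ℝ) : Prop where
  pos : ∀ x ≠ 0, 0 < g x
  smul : ∀ (r : ℝ), 0 < r → ∀ x, g (r • x) = r⁻¹ * g x
  continuousOn : ContinuousOn g {0}ᶜ

/-- The set with prescribed radial function. -/
def starSet (g : V → ℝ) : Set V := {x | x = 0 ∨ 1 ≤ g x}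

/-- By homogeneity, t • x lies in the set for t > 0 exactly when t ≤ g x, so the admissible t form
the interval [0, g x]. -/
theorem radialFunction_starSet {g : V → ℝ} (hg : IsRadial g) {x : V} (hx : x ≠ 0) :
    radialFunction (starSet g) x = g x := by
  have : {t : ℝ | 0 ≤ t ∧ t • x ∈ starSet g} = Set.Icc 0 (g x) := by
    ext t
    simp only [Set.mem_ofPred_eq, Set.mem_Icc]
    refine and_congr_right fun ht => ?_
    rcases ht.eq_or_lt with rfl | ht
    · simp [starSet, (hg.pos x hx).le]
    · simp only [starSet, Set.mem_ofPred_eq, smul_eq_zero, ht.ne', hx, false_or, hg.smul t ht]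
      rw [inv_mul_eq_div, one_le_div ht]
  rw [radialFunction, this, csSup_Icc (hg.pos x hx).le]

theorem IsRadial.smul_const {g : V → ℝ} (hg : IsRadial g) {c : ℝ} (hc : 0 < c) :
    IsRadial fun x => c * g x where
  pos x hx := mul_pos hc (hg.pos x hx)
  smul r hr x := by rw [hg.smul r hr]; ring
  continuousOn := continuousOn_const.mul hg.continuousOn

theorem smul_starSet {g : V → ℝ} (hg : IsRadial g) {c : ℝ} (hc : 0 < c) :
    c • starSet g = starSet fun x => c * g x := by
  ext x
  rw [Set.mem_smul_set_iff_inv_smul_mem₀ hc.ne']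
  simp [starSet, hg.smul c⁻¹ (inv_pos.2 hc), hc.ne']

omit [NormedSpace ℝ V] in
theorem isOpen_off_zero {g : V → ℝ} (hg : ContinuousOn g {0}ᶜ) {U : Set ℝ} (hU : IsOpen U) :
    IsOpen {x | x ≠ 0 ∧ g x ∈ U} :=
  hg.isOpen_inter_preimage isOpen_compl_singleton hU

/-- Homogeneity reduces the bounds to the unit sphere, where compactness gives a positive minimum
and a maximum. -/
theorem IsRadial.bounds [FiniteDimensional ℝ V] {g : V → ℝ} (hg : IsRadial g) :
    ∃ a b : ℝ, 0 < a ∧ 0 < b ∧ ∀ x ≠ 0, a / ‖x‖ ≤ g x ∧ g x ≤ b / ‖x‖ := by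
  have hsc : ∀ x : V, x ≠ 0 → g x = ‖x‖⁻¹ * g (‖x‖⁻¹ • x) := by
    intro x hx
    have hn : 0 < ‖x‖ := norm_pos_iff.2 hx
    rw [hg.smul _ (inv_pos.2 hn), inv_inv, inv_mul_cancel_left₀ hn.ne']
  have hmem : ∀ x : V, x ≠ 0 → ‖x‖⁻¹ • x ∈ Metric.sphere (0 : V) 1 := by
    intro x hx
    simp [norm_smul, norm_ne_zero_iff.2 hx]
  have : ProperSpace V := FiniteDimensional.proper ℝ V
  have hc := isCompact_sphere (0 : V) 1
  have h0 : ∀ x ∈ Metric.sphere (0 : V) 1, x ≠ 0 := by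
    rintro x hx rfl
    simp at hx
  have hcont : ContinuousOn g (Metric.sphere (0 : V) 1) :=
    hg.continuousOn.mono fun x hx => h0 x hx
  rcases (Metric.sphere (0 : V) 1).eq_empty_or_nonempty with he | hne
  -- An empty sphere means that there is no nonzero vector, so any constants serve.
  · refine ⟨1, 1, one_pos, one_pos, fun x hx => ?_⟩
    have := hmem x hx
    rw [he] at this
    exact this.elim
  obtain ⟨x₁, hx₁, hmin⟩ := hc.exists_isMinOn hne hcont
  obtain ⟨x₂, hx₂, hmax⟩ := hc.exists_isMaxOn hne hcont
  refine ⟨g x₁, g x₂, hg.pos _ (h0 _ hx₁), hg.pos _ (h0 _ hx₂), fun x hx => ?_⟩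
  rw [hsc x hx, div_eq_inv_mul, div_eq_inv_mul]
  exact ⟨mul_le_mul_of_nonneg_left (hmin (hmem x hx)) (by positivity),
    mul_le_mul_of_nonneg_left (hmax (hmem x hx)) (by positivity)⟩

theorem isStarBody_starSet [FiniteDimensional ℝ V] {g : V → ℝ} (hg : IsRadial g) :
    IsStarBody (starSet g) where
  isCompact := by
    have : ProperSpace V := FiniteDimensional.proper ℝ V
    obtain ⟨a, b, ha, hb, hab⟩ := hg.bounds
    refine Metric.isCompact_of_isClosed_isBounded ?_ ?_
    · rw [← isOpen_compl_iff]
      convert isOpen_off_zero hg.continuousOn (isOpen_Iio (a := (1 : ℝ))) using 1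
      ext x
      simp [starSet]
    · refine isBounded_iff_forall_norm_le.2 ⟨b, ?_⟩
      rintro x (rfl | hx)
      · simpa using hb.le
      · by_cases h0 : x = 0
        · simpa [h0] using hb.le
        · have := hx.trans (hab x h0).2
          rwa [one_le_div (norm_pos_iff.2 h0)] at this
  starConvex := by
    rw [starConvex_zero_iff]
    intro x hx t ht0 ht1
    rcases ht0.eq_or_lt with rfl | ht0
    · left; simp
    rcases hx with rfl | hx
    · left; simp
    · right
      rw [hg.smul t ht0]
      exact one_le_mul_of_one_le_of_one_le ((one_le_inv₀ ht0).2 ht1) hx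
  zero_mem_interior := by
    obtain ⟨a, b, ha, hb, hab⟩ := hg.bounds
    refine mem_interior_iff_mem_nhds.2 (Filter.mem_of_superset (Metric.closedBall_mem_nhds 0 ha) ?_)
    intro x hx
    by_cases h0 : x = 0
    · exact Or.inl h0
    · right
      refine le_trans ?_ (hab x h0).1
      rw [one_le_div (norm_pos_iff.2 h0)]
      simpa using hx
  continuousOn := hg.continuousOn.congr fun x hx => radialFunction_starSet hg hx


theorem IsStarBody.zero_mem {S : Set V} (hS : IsStarBody S) : (0 : V) ∈ S :=
  interior_subset hS.zero_mem_interior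

theorem IsStarBody.bddAbove {S : Set V} (hS : IsStarBody S) {x : V} (hx : x ≠ 0) :
    BddAbove {t : ℝ | 0 ≤ t ∧ t • x ∈ S} := by
  obtain ⟨R, hR⟩ := hS.isCompact.isBounded.exists_norm_le
  refine ⟨R / ‖x‖, fun t ht => ?_⟩
  rw [le_div_iff₀ (norm_pos_iff.2 hx)]
  have := hR _ ht.2
  rwa [norm_smul, Real.norm_of_nonneg ht.1] at this

theorem IsStarBody.radialFunction_pos {S : Set V} (hS : IsStarBody S) {x : V} (hx : x ≠ 0) :
    0 < radialFunction S x := by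
  have h1 : ∀ᶠ t : ℝ in nhds 0, t • x ∈ S := by
    have : ContinuousAt (fun t : ℝ => t • x) 0 := by fun_prop
    refine this.eventually_mem ?_
    simpa using mem_interior_iff_mem_nhds.1 hS.zero_mem_interior
  obtain ⟨ε, hε, h⟩ := Metric.eventually_nhds_iff.1 h1
  have h2 : (ε / 2) • x ∈ S := h (by simp [abs_of_pos hε, hε])
  exact lt_of_lt_of_le (by positivity : 0 < ε / 2) (le_csSup (hS.bddAbove hx) ⟨by positivity, h2⟩)

theorem IsStarBody.mem_iff {S : Set V} (hS : IsStarBody S) {x : V} (hx : x ≠ 0) : x ∈ S ↔ 1 ≤ radialFunction S x := by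
  constructor
  · intro h
    exact le_csSup (hS.bddAbove hx) ⟨zero_le_one, by simpa using h⟩
  · intro h
    have hcl : IsClosed {t : ℝ | 0 ≤ t ∧ t • x ∈ S} :=
      isClosed_Ici.inter (hS.isCompact.isClosed.preimage (by fun_prop : Continuous fun t : ℝ => t • x))
    have hmem := hcl.csSup_mem ⟨0, le_rfl, by simpa using hS.zero_mem⟩ (hS.bddAbove hx)
    have := (starConvex_zero_iff.1 hS.starConvex) hmem.2
      (a := (radialFunction S x)⁻¹) (by positivity) (inv_le_one_of_one_le₀ h)
    rwa [smul_smul, ← radialFunction, inv_mul_cancel₀ (by positivity), one_smul] at this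

theorem IsStarBody.isRadial {S : Set V} (hS : IsStarBody S) : IsRadial (radialFunction S) where
  pos x hx := hS.radialFunction_pos hx
  smul r hr x := by
    have : {t : ℝ | 0 ≤ t ∧ t • r • x ∈ S} = r⁻¹ • {t : ℝ | 0 ≤ t ∧ t • x ∈ S} := by
      ext t
      rw [Set.mem_smul_set_iff_inv_smul_mem₀ (inv_ne_zero hr.ne'), inv_inv]
      simp [smul_smul, mul_comm r t, hr]
    rw [radialFunction, this, Real.sSup_smul_of_nonneg (inv_nonneg.2 hr.le), smul_eq_mul,
      radialFunction]
  continuousOn := hS.continuousOn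

theorem IsStarBody.eq_starSet {S : Set V} (hS : IsStarBody S) : S = starSet (radialFunction S) := by
  ext x
  by_cases hx : x = 0
  · simp [hx, starSet, hS.zero_mem]
  · simp [starSet, hx, hS.mem_iff hx]

theorem IsStarBody.mem_frontier_iff {S : Set V} (hS : IsStarBody S) {x : V} :
    x ∈ frontier S ↔ x ≠ 0 ∧ radialFunction S x = 1 := by
  rw [hS.isCompact.isClosed.frontier_eq]
  constructor
  · rintro ⟨h1, h2⟩
    have hx : x ≠ 0 := by
      rintro rfl
      exact h2 hS.zero_mem_interior
    refine ⟨hx, le_antisymm ?_ ((hS.mem_iff hx).1 h1)⟩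
    by_contra! hlt
    refine h2 (mem_interior.2 ⟨_, ?_, isOpen_off_zero hS.continuousOn isOpen_Ioi, hx, hlt⟩)
    rintro y ⟨hy, hy1⟩
    exact (hS.mem_iff hy).2 (le_of_lt hy1)
  · rintro ⟨hx, h1⟩
    refine ⟨(hS.mem_iff hx).2 h1.ge, fun hi => ?_⟩
    -- An interior point could be pushed slightly outward within S, but its multiple by 1 + ε/2 has
    -- radial value below 1.
    have h2 : ∀ᶠ t : ℝ in nhds 1, t • x ∈ S := by
      have : ContinuousAt (fun t : ℝ => t • x) 1 := by fun_prop
      refine this.eventually_mem ?_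
      simpa using mem_interior_iff_mem_nhds.1 hi
    obtain ⟨ε, hε, h⟩ := Metric.eventually_nhds_iff.1 h2
    have h3 : (1 + ε / 2) • x ∈ S := h (by simp [abs_of_pos hε, hε])
    have h4 := (hS.mem_iff (smul_ne_zero (by positivity) hx)).1 h3
    rw [hS.isRadial.smul _ (by positivity), h1, mul_one, one_le_inv₀ (by positivity)] at h4
    linarith

theorem IsStarBody.eq_starSet_of_radialFunction_eq {S : Set V} (hS : IsStarBody S) {g : V → ℝ}
    (h : ∀ x ≠ 0, radialFunction S x = g x) : S = starSet g := by
  rw [hS.eq_starSet]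
  ext x
  by_cases hx : x = 0
  · simp [hx, starSet]
  · simp [starSet, hx, h x hx]

end Star

/-! ### Polar coordinates -/

section Polar

theorem lintegral_polar {m : ℕ} {F : EuclideanSpace ℝ (Fin (m + 1)) → ℝ≥0∞} (hF : Measurable F) :
    ∫⁻ x, F x = ∫⁻ x : Metric.sphere (0 : EuclideanSpace ℝ (Fin (m + 1))) 1,
      ∫⁻ r : Set.Ioi (0 : ℝ), F (r.1 • x.1) ∂Measure.volumeIoiPow m
        ∂(volume : Measure (EuclideanSpace ℝ (Fin (m + 1)))).toSphere := by
  have hmp := Measure.measurePreserving_homeomorphUnitSphereProd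
    (volume : Measure (EuclideanSpace ℝ (Fin (m + 1))))
  have hm : finrank ℝ (EuclideanSpace ℝ (Fin (m + 1))) - 1 = m := by simp
  rw [hm] at hmp
  have hmeas : Measurable fun p : Metric.sphere (0 : EuclideanSpace ℝ (Fin (m + 1))) 1 ×
      Set.Ioi (0 : ℝ) => F (p.2.1 • p.1.1) := by fun_prop
  rw [← lintegral_prod (fun p : Metric.sphere (0 : EuclideanSpace ℝ (Fin (m + 1))) 1 ×
      Set.Ioi (0 : ℝ) => F (p.2.1 • p.1.1)) hmeas.aemeasurable, ← hmp.lintegral_comp hmeas]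
  have h1 : ∀ x : ({0}ᶜ : Set (EuclideanSpace ℝ (Fin (m + 1)))),
      F (((homeomorphUnitSphereProd (EuclideanSpace ℝ (Fin (m + 1))) x).2 : ℝ) •
        ((homeomorphUnitSphereProd (EuclideanSpace ℝ (Fin (m + 1))) x).1 :
          EuclideanSpace ℝ (Fin (m + 1)))) = F x := by
    intro x
    rw [← homeomorphUnitSphereProd_symm_apply_coe, Homeomorph.symm_apply_apply]
  simp only [h1]
  rw [lintegral_subtype_comap (measurableSet_singleton _).compl, restrict_compl_singleton]

variable {V : Type*} [NormedAddCommGroup V] [NormedSpace ℝ V] {m : ℕ}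

theorem basis_sum_ne_zero {ι : Type*} [Fintype ι] (b : Basis ι ℝ V) {x : ι → ℝ} (hx : x ≠ 0) :
    ∑ j, x j • b j ≠ 0 := fun h =>
  hx (funext (Fintype.linearIndependent_iff.1 b.linearIndependent x h))

theorem sphere_basis_sum_ne_zero (b : Basis (Fin (m + 1)) ℝ V)
    (x : Metric.sphere (0 : EuclideanSpace ℝ (Fin (m + 1))) 1) :
    ∑ j, (x : EuclideanSpace ℝ (Fin (m + 1))) j • b j ≠ 0 := by
  refine basis_sum_ne_zero b fun h => ?_
  have : (x : EuclideanSpace ℝ (Fin (m + 1))) = 0 := by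
    ext j
    exact congrFun h j
  have h1 := x.2
  rw [this] at h1
  simp at h1

theorem continuous_sphere_comp {g : V → ℝ} (hg : ContinuousOn g {0}ᶜ)
    (b : Basis (Fin (m + 1)) ℝ V) :
    Continuous fun x : Metric.sphere (0 : EuclideanSpace ℝ (Fin (m + 1))) 1 =>
      g (∑ j, (x : EuclideanSpace ℝ (Fin (m + 1))) j • b j) :=
  hg.comp_continuous (by fun_prop) fun x => sphere_basis_sum_ne_zero b x

theorem isOpen_radial_gt (b : Basis (Fin (m + 1)) ℝ V) {ρ : V → ℝ} (hρ : ContinuousOn ρ {0}ᶜ) :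
    IsOpen {z : Fin (m + 1) → ℝ | z ≠ 0 ∧ 1 < ρ (∑ j, z j • b j)} := by
  convert (isOpen_off_zero hρ (isOpen_Ioi (a := (1 : ℝ)))).preimage
    (continuous_coord_sum (b : Fin (m + 1) → V)) using 1
  ext z
  simp only [Set.mem_preimage, Set.mem_ofPred_eq, Set.mem_Ioi]
  refine and_congr_left fun _ => ⟨basis_sum_ne_zero b, ?_⟩
  rintro h rfl
  simp at h

/-- On the ray through a sphere point p the integrand is the constant g(p)/ρ(p), and r^m integrates
over 0 < r < ρ(p) to ρ(p)^(m+1)/(m+1). The product is ρ(p)^m g(p)/(m+1). -/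
theorem setLIntegral_radial (b : Basis (Fin (m + 1)) ℝ V) {ρ g : V → ℝ}
    (hρ : IsRadial ρ) (hg : IsRadial g) :
    (m + 1 : ℝ≥0∞) * ∫⁻ z in {z : Fin (m + 1) → ℝ | z ≠ 0 ∧ 1 < ρ (∑ j, z j • b j)},
      ENNReal.ofReal (g (∑ j, z j • b j) / ρ (∑ j, z j • b j)) =
    ENNReal.ofReal (∫ x : Metric.sphere (0 : EuclideanSpace ℝ (Fin (m + 1))) 1,
      ρ (∑ j, (x : EuclideanSpace ℝ (Fin (m + 1))) j • b j) ^ m *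
        g (∑ j, (x : EuclideanSpace ℝ (Fin (m + 1))) j • b j)
          ∂(volume : Measure (EuclideanSpace ℝ (Fin (m + 1)))).toSphere) := by
  have hopen := isOpen_radial_gt b hρ.continuousOn
  set I := {z : Fin (m + 1) → ℝ | z ≠ 0 ∧ 1 < ρ (∑ j, z j • b j)} with hI
  set F : (Fin (m + 1) → ℝ) → ℝ≥0∞ := I.indicator fun z =>
    ENNReal.ofReal (g (∑ j, z j • b j) / ρ (∑ j, z j • b j)) with hF
  have hFm : Measurable F := by
    have hc : ContinuousOn (fun z : Fin (m + 1) → ℝ =>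
        ENNReal.ofReal (g (∑ j, z j • b j) / ρ (∑ j, z j • b j))) I := by
      refine ENNReal.continuous_ofReal.comp_continuousOn (ContinuousOn.div ?_ ?_ ?_)
      · exact hg.continuousOn.comp (continuous_coord_sum _).continuousOn
          fun z hz => basis_sum_ne_zero b hz.1
      · exact hρ.continuousOn.comp (continuous_coord_sum _).continuousOn
          fun z hz => basis_sum_ne_zero b hz.1
      · exact fun z hz => (zero_lt_one.trans hz.2).ne'
    have := hc.measurable_piecewise (g := 0) continuousOn_const hopen.measurableSet
    rwa [Set.piecewise_eq_indicator] at this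
  have hpolar := lintegral_polar (hFm.comp (MeasurableEquiv.toLp 2 (Fin (m + 1) → ℝ)).symm.measurable)
  rw [← lintegral_indicator hopen.measurableSet, ← hF,
    ← (EuclideanSpace.volume_preserving_symm_measurableEquiv_toLp (Fin (m + 1))).lintegral_comp hFm]
  refine (congrArg _ hpolar).trans ?_
  rw [
    ofReal_integral_eq_lintegral_ofReal, ← lintegral_const_mul' _ _ (by finiteness)]
  · refine lintegral_congr fun x => ?_
    set p := ∑ j, (x : EuclideanSpace ℝ (Fin (m + 1))) j • b j with hp
    have hp0 : p ≠ 0 := sphere_basis_sum_ne_zero b x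
    have hρp := hρ.pos p hp0
    have hgp := hg.pos p hp0
    have h1 : ∀ r : Set.Ioi (0 : ℝ), F ((MeasurableEquiv.toLp 2 (Fin (m + 1) → ℝ)).symm
        (r.1 • (x : EuclideanSpace ℝ (Fin (m + 1))))) =
        (Set.Iio (⟨ρ p, hρp⟩ : Set.Ioi (0 : ℝ))).indicator
          (fun _ => ENNReal.ofReal (g p / ρ p)) r := by
      rintro ⟨r, hr⟩
      have hr : 0 < r := hr
      have hsum : ∑ j, ((MeasurableEquiv.toLp 2 (Fin (m + 1) → ℝ)).symm
        (r • (x : EuclideanSpace ℝ (Fin (m + 1))))) j • b j = r • p := by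
        rw [hp, Finset.smul_sum]
        exact Finset.sum_congr rfl fun j _ => by simp [smul_smul]
      have hne : (MeasurableEquiv.toLp 2 (Fin (m + 1) → ℝ)).symm
        (r • (x : EuclideanSpace ℝ (Fin (m + 1)))) ≠ 0 := by
        intro h0
        rw [h0] at hsum
        simp only [Pi.zero_apply, zero_smul, Finset.sum_const_zero] at hsum
        exact smul_ne_zero hr.ne' hp0 hsum.symm
      by_cases hlt : r < ρ p
      · rw [hF, Set.indicator_of_mem, Set.indicator_of_mem]
        · rw [hsum, hρ.smul r hr, hg.smul r hr, mul_div_mul_left _ _ (inv_ne_zero hr.ne')]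
        · exact hlt
        · refine ⟨hne, ?_⟩
          rw [hsum, hρ.smul r hr, inv_mul_eq_div, one_lt_div hr]
          exact hlt
      · rw [hF, Set.indicator_of_notMem, Set.indicator_of_notMem]
        · exact hlt
        · rintro ⟨_, h2⟩
          rw [hsum, hρ.smul r hr, inv_mul_eq_div, one_lt_div hr] at h2
          exact hlt h2
    simp only [Function.comp_apply, h1]
    rw [lintegral_indicator measurableSet_Iio, lintegral_const, Measure.restrict_apply_univ,
      Measure.volumeIoiPow_apply_Iio]
    have hm : (m + 1 : ℝ≥0∞) = ENNReal.ofReal (m + 1) := by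
      rw [ENNReal.ofReal_add (by positivity) (by positivity)]; simp
    rw [hm, ← ENNReal.ofReal_mul (by positivity), ← ENNReal.ofReal_mul (by positivity)]
    congr 1
    field_simp
    ring
  · refine Continuous.integrable_of_hasCompactSupport ?_ (HasCompactSupport.of_compactSpace _)
    exact ((continuous_sphere_comp hρ.continuousOn b).pow m).mul
      (continuous_sphere_comp hg.continuousOn b)
  · refine Filter.Eventually.of_forall fun x => ?_
    exact mul_nonneg (pow_nonneg (hρ.pos _ (sphere_basis_sum_ne_zero b x)).le _)
      (hg.pos _ (sphere_basis_sum_ne_zero b x)).le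

end Polar

/-! ### The cone over a parametrized hypersurface -/

section Cone

variable {V : Type*} [NormedAddCommGroup V] [NormedSpace ℝ V] {m : ℕ}

/-- The cone map `(t, x) ↦ t φ(x)`, in the coordinates given by a basis. -/
def coneMap (b : Basis (Fin (m + 1)) ℝ V) (φ : (Fin m → ℝ) → V) (z : Fin (m + 1) → ℝ) :
    Fin (m + 1) → ℝ :=
  b.equivFun (z 0 • φ (fun i => z i.succ))

/-- The derivative of `coneMap`. -/
def coneMapDeriv [FiniteDimensional ℝ V] (b : Basis (Fin (m + 1)) ℝ V) (φ : (Fin m → ℝ) → V)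
    (z : Fin (m + 1) → ℝ) : (Fin (m + 1) → ℝ) →L[ℝ] (Fin (m + 1) → ℝ) :=
  (b.equivFunL : V →L[ℝ] (Fin (m + 1) → ℝ)).comp
    (z 0 • (fderiv ℝ φ fun i => z i.succ).comp
        (ContinuousLinearMap.pi fun i : Fin m => ContinuousLinearMap.proj i.succ) +
      (ContinuousLinearMap.proj 0).smulRight (φ fun i => z i.succ))

theorem sum_coneMap (b : Basis (Fin (m + 1)) ℝ V) (φ : (Fin m → ℝ) → V) (z : Fin (m + 1) → ℝ) :
    ∑ j, coneMap b φ z j • b j = z 0 • φ (fun i => z i.succ) :=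
  b.sum_equivFun _

theorem hasFDerivAt_coneMap [FiniteDimensional ℝ V] (b : Basis (Fin (m + 1)) ℝ V)
    {φ : (Fin m → ℝ) → V} {z : Fin (m + 1) → ℝ}
    (h : DifferentiableAt ℝ φ fun i => z i.succ) :
    HasFDerivAt (coneMap b φ) (coneMapDeriv b φ z) z := by
  have h1 : HasFDerivAt (fun z : Fin (m + 1) → ℝ => fun i : Fin m => z i.succ)
      (ContinuousLinearMap.pi fun i : Fin m => ContinuousLinearMap.proj (R := ℝ) i.succ) z :=
    (ContinuousLinearMap.pi fun i : Fin m =>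
      ContinuousLinearMap.proj (R := ℝ) (φ := fun _ : Fin (m + 1) => ℝ) i.succ).hasFDerivAt
  have h0 : HasFDerivAt (fun z : Fin (m + 1) → ℝ => z 0)
      (ContinuousLinearMap.proj (R := ℝ) 0) z :=
    (ContinuousLinearMap.proj (R := ℝ) (φ := fun _ : Fin (m + 1) => ℝ) 0).hasFDerivAt
  have h2 := h0.smul (HasFDerivAt.comp (g := φ) z h.hasFDerivAt h1)
  exact ((b.equivFunL : V →L[ℝ] (Fin (m + 1) → ℝ)).hasFDerivAt).comp z h2

/-- The derivative of the cone map has columns φ and t ∂_iφ, with t the zeroth coordinate.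
Evaluating Ω on them and extracting t from m slots gives the factor t^m. -/
theorem apply_basis_mul_det_coneMapDeriv [FiniteDimensional ℝ V] (b : Basis (Fin (m + 1)) ℝ V)
    (Ω : V [⋀^Fin (m + 1)]→ₗ[ℝ] ℝ) (φ : (Fin m → ℝ) → V) (z : Fin (m + 1) → ℝ) :
    Ω b * (coneMapDeriv b φ z).det = z 0 ^ m * Ω (Matrix.vecCons (φ fun i => z i.succ)
      fun i => fderiv ℝ φ (fun i => z i.succ) (Pi.single i 1)) := by
  set θ := Ω.compLinearMap (b.equivFun.symm : (Fin (m + 1) → ℝ) →ₗ[ℝ] V) with hθ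
  have h1 := congrArg (fun f => f (coneMapDeriv b φ z ∘ Pi.basisFun ℝ (Fin (m + 1))))
    (θ.eq_smul_basis_det (Pi.basisFun ℝ (Fin (m + 1))))
  have h2 : θ (Pi.basisFun ℝ (Fin (m + 1))) = Ω b := by
    rw [hθ, AlternatingMap.compLinearMap_apply]
    congr 1
    funext i
    simp [Module.Basis.equivFun_symm_apply, Pi.single_apply]
  simp only [AlternatingMap.smul_apply, smul_eq_mul, h2] at h1
  rw [show (coneMapDeriv b φ z ∘ Pi.basisFun ℝ (Fin (m + 1))) =
    ((coneMapDeriv b φ z : (Fin (m + 1) → ℝ) →ₗ[ℝ] (Fin (m + 1) → ℝ)) ∘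
      Pi.basisFun ℝ (Fin (m + 1))) from rfl, Basis.det_comp, Basis.det_self, mul_one] at h1
  rw [ContinuousLinearMap.det, ← h1, hθ, AlternatingMap.compLinearMap_apply]
  have h3 : (fun i => (b.equivFun.symm : (Fin (m + 1) → ℝ) →ₗ[ℝ] V)
      (((coneMapDeriv b φ z : (Fin (m + 1) → ℝ) →ₗ[ℝ] (Fin (m + 1) → ℝ)) ∘
        Pi.basisFun ℝ (Fin (m + 1))) i)) = Matrix.vecCons (φ fun i => z i.succ)
      fun i => z 0 • fderiv ℝ φ (fun i => z i.succ) (Pi.single i 1) := by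
    funext j
    have : ∀ v : V, b.equivFun.symm (b.equivFunL v) = v := fun v => b.equivFun.symm_apply_apply v
    refine Fin.cases ?_ (fun i => ?_) j
    · simp only [coneMapDeriv, Function.comp_apply, ContinuousLinearMap.coe_coe,
        ContinuousLinearMap.comp_apply, ContinuousLinearEquiv.coe_coe, LinearEquiv.coe_coe, this]
      have h0 : (fun i : Fin m => (Pi.single (0 : Fin (m + 1)) (1 : ℝ) : Fin (m + 1) → ℝ) i.succ)
          = 0 := by
        funext i; simp
      simp [ContinuousLinearMap.pi, LinearMap.pi]
      erw [h0]
      simp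
    · simp only [coneMapDeriv, Function.comp_apply, ContinuousLinearMap.coe_coe,
        ContinuousLinearMap.comp_apply, ContinuousLinearEquiv.coe_coe, LinearEquiv.coe_coe, this]
      have h0 : (fun k : Fin m => (Pi.single i.succ (1 : ℝ) : Fin (m + 1) → ℝ) k.succ)
          = Pi.single i 1 := by
        funext k
        simp [Pi.single_apply]
      simp [ContinuousLinearMap.pi, LinearMap.pi]
      erw [h0]
  rw [h3, ← AlternatingMap.curryLeft_apply_apply, AlternatingMap.map_smul_univ]
  simp

end Cone

/-! ### Integration over truncated cones -/

section ConeIntegral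

variable {m : ℕ}

/-- The open truncated cone `(0, 1) × A` in coordinates. -/
def coneDomain (A : Set (Fin m → ℝ)) : Set (Fin (m + 1) → ℝ) :=
  {z | z 0 ∈ Set.Ioo (0 : ℝ) 1 ∧ (fun i => z i.succ) ∈ A}

theorem measurable_tail : Measurable fun (z : Fin (m + 1) → ℝ) (i : Fin m) => z i.succ := by
  fun_prop

theorem measurableSet_coneDomain {A : Set (Fin m → ℝ)} (hA : MeasurableSet A) :
    MeasurableSet (coneDomain A) :=
  (measurableSet_Ioo.preimage (measurable_pi_apply 0)).inter (hA.preimage measurable_tail)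

theorem setLIntegral_Ioo_pow (m : ℕ) :
    ∫⁻ t in Set.Ioo (0 : ℝ) 1, ENNReal.ofReal (t ^ m) = ((m : ℝ≥0∞) + 1)⁻¹ := by
  rw [← ofReal_integral_eq_lintegral_ofReal]
  · rw [← integral_Ioc_eq_integral_Ioo, ← intervalIntegral.integral_of_le zero_le_one,
      integral_pow, one_pow, zero_pow (Nat.succ_ne_zero m), sub_zero, one_div,
      ENNReal.ofReal_inv_of_pos (by positivity), ENNReal.ofReal_add (by positivity) (by positivity)]
    simp
  · exact ((continuous_pow m).integrableOn_Icc (a := (0 : ℝ)) (b := 1)).mono_set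
      Set.Ioo_subset_Icc_self
  · exact (ae_restrict_mem measurableSet_Ioo).mono fun t ht => pow_nonneg ht.1.le m

/-- Tonelli on (0, 1) × A: the factor m + 1 cancels the integral of t^m. -/
theorem setLIntegral_coneDomain {A : Set (Fin m → ℝ)}
    {f : (Fin m → ℝ) → ℝ≥0∞} (hf : AEMeasurable f (volume.restrict A)) :
    ((m : ℝ≥0∞) + 1) * ∫⁻ z in coneDomain A, ENNReal.ofReal (z 0 ^ m) * f (fun i => z i.succ) =
      ∫⁻ x in A, f x := by
  have he : ∀ z : Fin (m + 1) → ℝ, MeasurableEquiv.piFinSuccAbove (fun _ => ℝ) 0 z =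
      (z 0, fun i => z i.succ) := fun z => by
    ext i
    · simp [MeasurableEquiv.piFinSuccAbove]
    · simp [MeasurableEquiv.piFinSuccAbove, Fin.insertNthEquiv, Fin.tail]
  have h1 := (volume_preserving_piFinSuccAbove (fun _ : Fin (m + 1) => ℝ) 0).setLIntegral_comp_preimage_emb
    (MeasurableEquiv.measurableEmbedding _)
    (fun p : ℝ × (Fin m → ℝ) => ENNReal.ofReal (p.1 ^ m) * f p.2) (Set.Ioo (0 : ℝ) 1 ×ˢ A)
  have h2 : MeasurableEquiv.piFinSuccAbove (fun _ : Fin (m + 1) => ℝ) 0 ⁻¹' (Set.Ioo (0 : ℝ) 1 ×ˢ A) =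
      coneDomain A := by
    ext z
    rw [Set.mem_preimage, he z]
    rfl
  rw [h2] at h1
  simp only [he] at h1
  rw [h1, Measure.volume_eq_prod, ← Measure.prod_restrict, 
    lintegral_prod_mul (f := fun t : ℝ => ENNReal.ofReal (t ^ m)) ?_ hf,
    setLIntegral_Ioo_pow, ← mul_assoc, ENNReal.mul_inv_cancel (by simp) (by finiteness), one_mul]
  exact (by fun_prop : Measurable fun t : ℝ => ENNReal.ofReal (t ^ m)).aemeasurable

end ConeIntegral

/-! ### Change of variables from a boundary chart to its cone -/

section Chart

variable {V : Type*} [NormedAddCommGroup V] [NormedSpace ℝ V] {m : ℕ} {S : Set V}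

/-- The radial function is 1 on the boundary, so a ray meets the boundary only once. This makes cone
maps injective and cones over disjoint pieces disjoint. -/
theorem frontier_ray_unique (hS : IsStarBody S) {p q : V} (hp : p ∈ frontier S)
    (hq : q ∈ frontier S) {s t : ℝ} (hs : 0 < s) (ht : 0 < t) (h : s • p = t • q) :
    s = t ∧ p = q := by
  have h1 := congrArg (radialFunction S) h
  rw [hS.isRadial.smul s hs, hS.isRadial.smul t ht, (hS.mem_frontier_iff.1 hp).2,
    (hS.mem_frontier_iff.1 hq).2, mul_one, mul_one, inv_inj] at h1
  subst h1
  exact ⟨rfl, smul_right_injective V hs.ne' h⟩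

variable (b : Basis (Fin (m + 1)) ℝ V) {φ : (Fin m → ℝ) → V} {U A : Set (Fin m → ℝ)}

theorem injOn_coneMap (hS : IsStarBody S) (hφ : IsParametrization (frontier S) φ U) (hA : A ⊆ U) :
    Set.InjOn (coneMap b φ) (coneDomain A) := by
  intro z hz w hw h
  obtain ⟨h0, h1⟩ := frontier_ray_unique hS (hφ.mapsTo (hA hz.2)) (hφ.mapsTo (hA hw.2))
    hz.1.1 hw.1.1 (b.equivFun.injective h)
  have h2 := hφ.injOn (hA hz.2) (hA hw.2) h1
  funext j
  exact Fin.cases h0 (fun i => congrFun h2 i) j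

theorem hasFDerivAt_coneMap_of_mem [FiniteDimensional ℝ V]
    (hφ : IsParametrization (frontier S) φ U) (hA : A ⊆ U)
    {z : Fin (m + 1) → ℝ} (hz : z ∈ coneDomain A) :
    HasFDerivAt (coneMap b φ) (coneMapDeriv b φ z) z :=
  hasFDerivAt_coneMap b ((hφ.contDiffOn.contDiffAt (hφ.isOpen.mem_nhds (hA hz.2))).differentiableAt
    (by simp))

theorem measurableSet_coneMap_image [FiniteDimensional ℝ V] (hS : IsStarBody S)
    (hφ : IsParametrization (frontier S) φ U) (hA : A ⊆ U) (hAm : MeasurableSet A) :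
    MeasurableSet (coneMap b φ '' coneDomain A) :=
  measurable_image_of_fderivWithin (measurableSet_coneDomain hAm)
    (fun _ hz => (hasFDerivAt_coneMap_of_mem b hφ hA hz).hasFDerivWithinAt)
    (injOn_coneMap b hS hφ hA)

theorem coneMap_image_subset (hS : IsStarBody S)
    (hφ : IsParametrization (frontier S) φ U) (hA : A ⊆ U) :
    coneMap b φ '' coneDomain A ⊆
      {z | z ≠ 0 ∧ 1 < radialFunction S (∑ j, z j • b j)} := by
  rintro _ ⟨z, hz, rfl⟩
  obtain ⟨h0, h1⟩ := hS.mem_frontier_iff.1 (hφ.mapsTo (hA hz.2))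
  constructor
  · intro h
    have := sum_coneMap b φ z
    simp only [h, Pi.zero_apply, zero_smul, Finset.sum_const_zero] at this
    exact smul_ne_zero hz.1.1.ne' h0 this.symm
  · rw [sum_coneMap, hS.isRadial.smul _ hz.1.1, h1, mul_one]
    exact (one_lt_inv₀ hz.1.1).2 hz.1.2

theorem disjoint_coneMap_image (hS : IsStarBody S) {φ' : (Fin m → ℝ) → V}
    {U' A' : Set (Fin m → ℝ)} (hφ : IsParametrization (frontier S) φ U) (hA : A ⊆ U)
    (hφ' : IsParametrization (frontier S) φ' U') (hA' : A' ⊆ U')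
    (hd : Disjoint (φ '' A) (φ' '' A')) :
    Disjoint (coneMap b φ '' coneDomain A) (coneMap b φ' '' coneDomain A') := by
  rw [Set.disjoint_left]
  rintro _ ⟨z, hz, rfl⟩ ⟨w, hw, h⟩
  have h2 := (frontier_ray_unique hS (hφ.mapsTo (hA hz.2)) (hφ'.mapsTo (hA' hw.2))
    hz.1.1 hw.1.1 (b.equivFun.injective h.symm)).2
  exact Set.disjoint_left.1 hd ⟨_, hz.2, rfl⟩ (h2 ▸ ⟨_, hw.2, rfl⟩)

theorem continuous_alternating [FiniteDimensional ℝ V] {k : ℕ} (Ω : V [⋀^Fin k]→ₗ[ℝ] ℝ)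
    (hk : finrank ℝ V = k) : Continuous fun v : Fin k → V => Ω v := by
  let b := finBasisOfFinrankEq ℝ V hk
  rw [Ω.eq_smul_basis_det b]
  simp only [AlternatingMap.smul_apply, Basis.det_apply]
  refine continuous_const.mul (Continuous.matrix_det ?_)
  refine continuous_matrix fun i j => ?_
  exact ((LinearMap.continuous_of_finiteDimensional (b.coord i)).comp (continuous_apply j))

/-- At tφ(x) the quotient g/ρ_S equals g(φ(x)), because both functions scale by 1/t and ρ_S = 1 on
the boundary. The change of variables for the cone map supplies t^m |Ω(φ, ∂φ)|, and integrating out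
t finishes. -/
theorem setLIntegral_chart [FiniteDimensional ℝ V] (Ω : V [⋀^Fin (m + 1)]→ₗ[ℝ] ℝ)
    (hS : IsStarBody S) {g : V → ℝ} (hg : IsRadial g)
    (hφ : IsParametrization (frontier S) φ U) (hA : A ⊆ U) (hAm : MeasurableSet A) :
    ∫⁻ x in A, ENNReal.ofReal (g (φ x) *
        |Ω (Matrix.vecCons (φ x) fun i => fderiv ℝ φ x (Pi.single i 1))|) =
      ENNReal.ofReal |Ω b| * (((m : ℝ≥0∞) + 1) * ∫⁻ z in coneMap b φ '' coneDomain A,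
        ENNReal.ofReal (g (∑ j, z j • b j) / radialFunction S (∑ j, z j • b j))) := by
  have hk : finrank ℝ V = m + 1 := by simpa using finrank_eq_card_basis b
  rw [lintegral_image_eq_lintegral_abs_det_fderiv_mul volume (measurableSet_coneDomain hAm)
    (fun _ hz => (hasFDerivAt_coneMap_of_mem b hφ hA hz).hasFDerivWithinAt)
    (injOn_coneMap b hS hφ hA), mul_left_comm, ← lintegral_const_mul' _ _ (by finiteness),
    ← setLIntegral_coneDomain]
  · congr 1
    refine setLIntegral_congr_fun (measurableSet_coneDomain hAm) fun z hz => ?_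
    obtain ⟨h0, h1⟩ := hS.mem_frontier_iff.1 (hφ.mapsTo (hA hz.2))
    have hz0 := hz.1.1
    have hd := apply_basis_mul_det_coneMapDeriv b Ω φ z
    rw [sum_coneMap, hg.smul _ hz0, hS.isRadial.smul _ hz0, h1,
      mul_div_mul_left _ _ (inv_ne_zero hz0.ne'), div_one, ← ENNReal.ofReal_mul (by positivity),
      ← ENNReal.ofReal_mul (by positivity), ← ENNReal.ofReal_mul (by positivity), 
      ← mul_assoc |Ω b|, ← abs_mul, hd, abs_mul, abs_of_pos (pow_pos hz0 m)]
    congr 1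
    ring
  · refine (ContinuousOn.aemeasurable ?_ hAm)
    refine ContinuousOn.mono ?_ hA
    refine ENNReal.continuous_ofReal.comp_continuousOn (ContinuousOn.mul ?_ ?_)
    · exact hg.continuousOn.comp hφ.contDiffOn.continuousOn fun x hx =>
        (hS.mem_frontier_iff.1 (hφ.mapsTo hx)).1
    · refine ((continuous_alternating Ω hk).comp_continuousOn (continuousOn_pi.2 fun j => ?_)).abs
      refine Fin.cases ?_ (fun i => ?_) j
      · exact hφ.contDiffOn.continuousOn
      · exact (hφ.contDiffOn.continuousOn_fderiv_of_isOpen hφ.isOpen (by simp)).clm_apply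
          continuousOn_const

end Chart

/-! ### Two charts by central projection that cover almost all of the boundary -/

section CentralCharts

variable {V : Type*} [NormedAddCommGroup V] [NormedSpace ℝ V] {m : ℕ} {S : Set V}

/-- The point `± b_0 + ∑ y_i b_i` of an affine hyperplane. -/
def hyperplanePoint (b : Basis (Fin (m + 1)) ℝ V) (σ : ℝ) (y : Fin m → ℝ) : V :=
  σ • b 0 + ∑ i, y i • b i.succ

/-- Radial projection of an affine hyperplane to the boundary of `S`. -/
def centralChart (b : Basis (Fin (m + 1)) ℝ V) (S : Set V) (σ : ℝ) (y : Fin m → ℝ) : V :=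
  radialFunction S (hyperplanePoint b σ y) • hyperplanePoint b σ y

variable (b : Basis (Fin (m + 1)) ℝ V)

theorem hyperplanePoint_eq (σ : ℝ) (y : Fin m → ℝ) :
    hyperplanePoint b σ y = ∑ j, (Fin.cons σ y : Fin (m + 1) → ℝ) j • b j := by
  simp [hyperplanePoint, Fin.sum_univ_succ]

theorem coord_hyperplanePoint (σ : ℝ) (y : Fin m → ℝ) (j : Fin (m + 1)) :
    b.coord j (hyperplanePoint b σ y) = (Fin.cons σ y : Fin (m + 1) → ℝ) j := by
  rw [hyperplanePoint_eq, Basis.coord_apply, Basis.repr_sum_self]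

theorem hyperplanePoint_ne_zero {σ : ℝ} (hσ : σ ≠ 0) (y : Fin m → ℝ) :
    hyperplanePoint b σ y ≠ 0 := fun h => hσ <| by
  simpa [h] using (coord_hyperplanePoint b σ y 0).symm

theorem centralChart_mem (hS : IsStarBody S) {σ : ℝ} (hσ : σ ≠ 0) (y : Fin m → ℝ) :
    centralChart b S σ y ∈ frontier S := by
  have h0 := hyperplanePoint_ne_zero b hσ y
  have h1 := hS.radialFunction_pos h0
  rw [hS.mem_frontier_iff]
  refine ⟨smul_ne_zero h1.ne' h0, ?_⟩
  rw [centralChart, hS.isRadial.smul _ h1, inv_mul_cancel₀ h1.ne']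

/-- The zeroth coordinates of the two images are sσ and tτ; since |σ| = |τ| = 1 and s, t > 0, the
scaling factors agree and can be cancelled. -/
theorem centralChart_inj (hS : IsStarBody S) {σ τ : ℝ} (hσ : |σ| = 1) (hτ : |τ| = 1)
    {y z : Fin m → ℝ} (h : centralChart b S σ y = centralChart b S τ z) : σ = τ ∧ y = z := by
  have hσ0 : σ ≠ 0 := by rintro rfl; simp at hσ
  have hτ0 : τ ≠ 0 := by rintro rfl; simp at hτ
  have hs := hS.radialFunction_pos (hyperplanePoint_ne_zero b hσ0 y)
  have ht := hS.radialFunction_pos (hyperplanePoint_ne_zero b hτ0 z)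
  unfold centralChart at h
  set s := radialFunction S (hyperplanePoint b σ y)
  set t := radialFunction S (hyperplanePoint b τ z)
  have hc : ∀ j, s * (Fin.cons σ y : Fin (m + 1) → ℝ) j =
      t * (Fin.cons τ z : Fin (m + 1) → ℝ) j := fun j => by
    have := congrArg (b.coord j) h
    simpa only [map_smul, smul_eq_mul, coord_hyperplanePoint] using this
  have h0 : s * σ = t * τ := hc 0
  have hst : s = t := by
    have := congrArg abs h0
    rwa [abs_mul, abs_mul, hσ, hτ, mul_one, mul_one, abs_of_pos hs, abs_of_pos ht] at this
  rw [hst] at hc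
  have h1 : ∀ j, (Fin.cons σ y : Fin (m + 1) → ℝ) j = (Fin.cons τ z : Fin (m + 1) → ℝ) j :=
    fun j => mul_left_cancel₀ ht.ne' (hc j)
  exact ⟨h1 0, funext fun i => h1 i.succ⟩

theorem contDiff_hyperplanePoint (σ : ℝ) : ContDiff ℝ (⊤ : ℕ∞) (hyperplanePoint b σ) := by
  unfold hyperplanePoint
  fun_prop

theorem contDiff_centralChart [FiniteDimensional ℝ V] (hS : IsSmoothStarBody S) {σ : ℝ}
    (hσ : σ ≠ 0) : ContDiff ℝ (⊤ : ℕ∞) (centralChart b S σ) :=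
  ContDiff.smul (hS.contDiffOn.comp_contDiff (contDiff_hyperplanePoint b σ)
    fun y => hyperplanePoint_ne_zero b hσ y) (contDiff_hyperplanePoint b σ)

theorem isParametrization_centralChart [FiniteDimensional ℝ V] (hS : IsSmoothStarBody S) {σ : ℝ}
    (hσ : |σ| = 1) : IsParametrization (frontier S) (centralChart b S σ) Set.univ := by
  have hσ0 : σ ≠ 0 := by rintro rfl; simp at hσ
  refine ⟨isOpen_univ, (contDiff_centralChart b hS hσ0).contDiffOn, fun y _ z _ h =>
    (centralChart_inj b hS.toIsStarBody hσ hσ h).2, fun y _ =>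
    centralChart_mem b hS.toIsStarBody hσ0 y, fun y _ => ?_⟩
  have hρ : DifferentiableAt ℝ (fun y => radialFunction S (hyperplanePoint b σ y)) y :=
    ((hS.contDiffOn.comp_contDiff (contDiff_hyperplanePoint b σ)
      fun y => hyperplanePoint_ne_zero b hσ0 y).differentiable (by simp)) y
  have hq : HasFDerivAt (hyperplanePoint b σ)
      (∑ i : Fin m, (ContinuousLinearMap.proj (R := ℝ) (φ := fun _ : Fin m => ℝ) i).smulRight
        (b i.succ)) y := by
    have h1 : HasFDerivAt (fun y : Fin m → ℝ => ∑ i, y i • b i.succ)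
        (∑ i : Fin m, (ContinuousLinearMap.proj (R := ℝ) (φ := fun _ : Fin m => ℝ) i).smulRight
        (b i.succ)) y := by
      convert (∑ i : Fin m, (ContinuousLinearMap.proj (R := ℝ) (φ := fun _ : Fin m => ℝ) i).smulRight
        (b i.succ)).hasFDerivAt (x := y) using 1
      ext y
      simp
    exact h1.const_add _
  have hφ := hρ.hasFDerivAt.smul hq
  have hpos := hS.toIsStarBody.radialFunction_pos (hyperplanePoint_ne_zero b hσ0 y)
  change Function.Injective (fderiv ℝ ((fun y => radialFunction S (hyperplanePoint b σ y)) •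
    hyperplanePoint b σ) y)
  rw [hφ.fderiv, injective_iff_map_eq_zero]
  intro w hw
  set r := fderiv ℝ (fun y => radialFunction S (hyperplanePoint b σ y)) y w with hr
  have hw' : radialFunction S (hyperplanePoint b σ y) • ∑ i, w i • b i.succ +
      r • hyperplanePoint b σ y = 0 := by
    simpa using hw
  have hp : hyperplanePoint b 0 w = ∑ i, w i • b i.succ := by simp [hyperplanePoint]
  rw [← hp] at hw'
  have hc := fun j => congrArg (b.coord j) hw'
  simp only [map_add, map_smul, coord_hyperplanePoint, map_zero, smul_eq_mul] at hc
  -- In the zeroth coordinate the tangential term vanishes and rσ = 0 remains.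
  have hr0 : r = 0 := by
    have := hc 0
    simpa [hσ0] using this
  funext i
  have := hc i.succ
  simpa [hr0, hpos.ne'] using this

/-- Dividing by |z_0| moves the point onto the affine hyperplane at height ±1. Its cone parameter is
|z_0| over the radial value there, which is below 1 because the point has radial value above 1. -/
theorem coneMap_centralChart_image (hS : IsStarBody S) {z : Fin (m + 1) → ℝ} (hz : z 0 ≠ 0)
    (hz1 : 1 < radialFunction S (∑ j, z j • b j)) :
    z ∈ coneMap b (centralChart b S (z 0 / |z 0|)) '' coneDomain Set.univ := by
  have ha : 0 < |z 0| := abs_pos.2 hz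
  set σ := z 0 / |z 0| with hσ
  set y : Fin m → ℝ := fun i => z i.succ / |z 0| with hy
  have hq : ∑ j, z j • b j = |z 0| • hyperplanePoint b σ y := by
    rw [hyperplanePoint, Fin.sum_univ_succ, smul_add, smul_smul, Finset.smul_sum]
    congr 1
    · rw [hσ, mul_div_cancel₀ _ ha.ne']
    · refine Finset.sum_congr rfl fun i _ => ?_
      rw [smul_smul, hy, mul_div_cancel₀ _ ha.ne']
  have hσ0 : σ ≠ 0 := div_ne_zero hz ha.ne'
  have hρ := hS.radialFunction_pos (hyperplanePoint_ne_zero b hσ0 y)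
  rw [hq, hS.isRadial.smul _ ha, inv_mul_eq_div, one_lt_div ha] at hz1
  refine ⟨Fin.cons (|z 0| / radialFunction S (hyperplanePoint b σ y)) y, ⟨⟨?_, ?_⟩, trivial⟩, ?_⟩
  · simp only [Fin.cons_zero]; positivity
  · simp only [Fin.cons_zero]
    exact (div_lt_one hρ).2 hz1
  · simp only [coneMap, Fin.cons_zero, Fin.cons_succ, centralChart]
    rw [smul_smul, div_mul_cancel₀ _ hρ.ne', ← hq, ← b.equivFun_symm_apply,
      LinearEquiv.apply_symm_apply]

end CentralCharts

/-! ### Dual surface area as a spherical integral -/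

section DualSurfaceArea

universe u
variable {V : Type u} [NormedAddCommGroup V] [NormedSpace ℝ V] [FiniteDimensional ℝ V] {m : ℕ}
  {S : Set V}

/-- Each chart integral becomes an integral over a cone. For any admissible family the cones are
disjoint and lie in the set ρ_S > 1, which bounds the supremum from above. The two central charts
attain the bound, as their cones miss only points of the hyperplane z_0 = 0. -/
theorem dualSurfaceArea_eq_lintegral (b : Basis (Fin (m + 1)) ℝ V)
    (Ω : V [⋀^Fin (m + 1)]→ₗ[ℝ] ℝ) (hS : IsSmoothStarBody S) {g : V → ℝ}
    (hg : IsRadial g) {μ : VolumeAssignment.{u}}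
    (hμ : ∀ p ≠ 0, ∀ v : Fin m → V, quotientDensity μ p v = g p * |Ω (Matrix.vecCons p v)|) :
    dualSurfaceArea μ m S = ENNReal.ofReal |Ω b| * (((m : ℝ≥0∞) + 1) *
      ∫⁻ z in {z : Fin (m + 1) → ℝ | z ≠ 0 ∧ 1 < radialFunction S (∑ j, z j • b j)},
        ENNReal.ofReal (g (∑ j, z j • b j) / radialFunction S (∑ j, z j • b j))) := by
  have hS' := hS.toIsStarBody
  have hchart : ∀ {φ : (Fin m → ℝ) → V} {U A : Set (Fin m → ℝ)},
      IsParametrization (frontier S) φ U → A ⊆ U → MeasurableSet A →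
      ∫⁻ x in A, ENNReal.ofReal
        (quotientDensity μ (φ x) fun i => fderiv ℝ φ x (Pi.single i 1)) =
      ENNReal.ofReal |Ω b| * (((m : ℝ≥0∞) + 1) * ∫⁻ z in coneMap b φ '' coneDomain A,
        ENNReal.ofReal (g (∑ j, z j • b j) / radialFunction S (∑ j, z j • b j))) := by
    intro φ U A hφ hA hAm
    rw [← setLIntegral_chart b Ω hS' hg hφ hA hAm]
    refine setLIntegral_congr_fun hAm fun x hx => ?_
    simp only [hμ _ (hS'.mem_frontier_iff.1 (hφ.mapsTo (hA hx))).1]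
  refine le_antisymm ?_ ?_
  · unfold dualSurfaceArea densityIntegral
    refine iSup_le fun N => iSup_le fun φ => iSup_le fun U => iSup_le fun A => iSup_le fun hφ =>
      iSup_le fun hA => iSup_le fun hd => ?_
    rw [Finset.sum_congr rfl fun j _ => hchart (hφ j) (hA j).1 (hA j).2, ← Finset.mul_sum,
      ← Finset.mul_sum, ← tsum_fintype (L := .unconditional _), ← lintegral_iUnion
        (fun j => measurableSet_coneMap_image b hS' (hφ j) (hA j).1 (hA j).2)
        (fun i j hij => disjoint_coneMap_image b hS' (hφ i) (hA i).1 (hφ j) (hA j).1 (hd hij))]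
    gcongr
    exact Set.iUnion_subset fun j => coneMap_image_subset b hS' (hφ j) (hA j).1
  · let σ : Fin 2 → ℝ := ![1, -1]
    have hσ : ∀ j, |σ j| = 1 := by
      intro j; fin_cases j <;> simp [σ]
    have hσi : Function.Injective σ := by
      intro i j hij
      fin_cases i <;> fin_cases j <;> simp [σ] at hij ⊢ <;> norm_num at hij
    have hφ := fun j => isParametrization_centralChart b hS (hσ j)
    have hd : Pairwise fun j j' => Disjoint (centralChart b S (σ j) '' Set.univ)
        (centralChart b S (σ j') '' Set.univ) := by
      intro i j hij
      rw [Set.disjoint_left]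
      rintro _ ⟨y, _, rfl⟩ ⟨z, _, h⟩
      exact hij (hσi (centralChart_inj b hS' (hσ j) (hσ i) h).1.symm)
    refine le_trans ?_ (le_iSup_of_le 2 <| le_iSup_of_le (fun j => centralChart b S (σ j)) <|
      le_iSup_of_le (fun _ => Set.univ) <| le_iSup_of_le (fun _ => Set.univ) <|
      le_iSup_of_le hφ <| le_iSup_of_le (fun j => ⟨subset_rfl, MeasurableSet.univ⟩) <|
      le_iSup_of_le hd le_rfl)
    rw [Finset.sum_congr rfl fun j _ => hchart (hφ j) subset_rfl MeasurableSet.univ,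
      ← Finset.mul_sum,
      ← Finset.mul_sum, ← tsum_fintype (L := .unconditional _), ← lintegral_iUnion
        (fun j => measurableSet_coneMap_image b hS' (hφ j) subset_rfl MeasurableSet.univ)
        (fun i j hij => disjoint_coneMap_image b hS' (hφ i) subset_rfl (hφ j) subset_rfl (hd hij))]
    refine mul_le_mul' le_rfl (mul_le_mul' le_rfl (lintegral_mono_set' ?_))
    have hnull : ∀ᵐ z : Fin (m + 1) → ℝ, z 0 ≠ 0 := by
      have h1 : volume ((LinearMap.ker (LinearMap.proj (R := ℝ) (φ := fun _ : Fin (m + 1) => ℝ) 0) :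
          Submodule ℝ (Fin (m + 1) → ℝ)) : Set (Fin (m + 1) → ℝ)) = 0 := by
        refine Measure.addHaar_submodule _ _ fun h => ?_
        have : (Pi.single 0 1 : Fin (m + 1) → ℝ) ∈
            LinearMap.ker (LinearMap.proj (R := ℝ) (φ := fun _ : Fin (m + 1) => ℝ) 0) :=
          h ▸ Submodule.mem_top
        simp at this
      exact measure_eq_zero_iff_ae_notMem.1 h1
    filter_upwards [hnull] with z hz hzI
    have hmem := coneMap_centralChart_image b hS' hz hzI.2
    rcases lt_or_gt_of_ne hz with h | h
    · refine Set.mem_iUnion.2 ⟨1, ?_⟩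
      rwa [abs_of_neg h, div_neg, div_self hz] at hmem
    · refine Set.mem_iUnion.2 ⟨0, ?_⟩
      rwa [abs_of_pos h, div_self hz] at hmem

theorem dualSurfaceArea_eq_integral (b : Basis (Fin (m + 1)) ℝ V)
    (Ω : V [⋀^Fin (m + 1)]→ₗ[ℝ] ℝ) (hS : IsSmoothStarBody S) {g : V → ℝ}
    (hg : IsRadial g) {μ : VolumeAssignment.{u}}
    (hμ : ∀ p ≠ 0, ∀ v : Fin m → V, quotientDensity μ p v = g p * |Ω (Matrix.vecCons p v)|) :
    dualSurfaceArea μ m S = ENNReal.ofReal (|Ω b| *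
      ∫ x : Metric.sphere (0 : EuclideanSpace ℝ (Fin (m + 1))) 1,
        radialFunction S (∑ j, (x : EuclideanSpace ℝ (Fin (m + 1))) j • b j) ^ m *
        g (∑ j, (x : EuclideanSpace ℝ (Fin (m + 1))) j • b j)
          ∂(volume : Measure (EuclideanSpace ℝ (Fin (m + 1)))).toSphere) := by
  rw [dualSurfaceArea_eq_lintegral b Ω hS hg hμ,
    setLIntegral_radial b hS.toIsStarBody.isRadial hg, ENNReal.ofReal_mul (abs_nonneg _)]

theorem exists_basis_mul_dualMixedVolume (hV : finrank ℝ V = m + 1)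
    {Ω : V [⋀^Fin (m + 1)]→ₗ[ℝ] ℝ} (hΩ : Ω ≠ 0) :
    ∃ b : Basis (Fin (m + 1)) ℝ V, Ω b ≠ 0 ∧ ∀ S T : Set V,
      (m + 1 : ℝ) * dualMixedVolume Ω (Fin.snoc (α := fun _ => Set V) (fun _ : Fin m => S) T) =
        |Ω b| * ∫ x : Metric.sphere (0 : EuclideanSpace ℝ (Fin (m + 1))) 1,
        radialFunction S (∑ j, (x : EuclideanSpace ℝ (Fin (m + 1))) j • b j) ^ m *
        radialFunction T (∑ j, (x : EuclideanSpace ℝ (Fin (m + 1))) j • b j)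
          ∂(volume : Measure (EuclideanSpace ℝ (Fin (m + 1)))).toSphere := by
  have h : ∃ b, Ω b ≠ 0 :=
    ⟨finBasisOfFinrankEq ℝ V hV, apply_basis_ne_zero hΩ _⟩
  obtain ⟨b, hb⟩ := exists_basis_of_apply_ne_zero hV h.choose_spec
  refine ⟨b, apply_basis_ne_zero hΩ b, fun S T => ?_⟩
  rw [dualMixedVolume, dif_pos h, ← hb]
  have hm : (m + 1 : ℝ) ≠ 0 := by positivity
  simp only [Fin.prod_univ_castSucc, Fin.snoc_castSucc, Fin.snoc_last, Finset.prod_const,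
    Finset.card_univ, Fintype.card_fin]
  push_cast
  field_simp

end DualSurfaceArea

/-! ### Existence and uniqueness of dual isoperimetrices -/

section Uniqueness

universe u
variable {V : Type u} [NormedAddCommGroup V] [NormedSpace ℝ V] {m : ℕ}

/-- Dual surface area and dual mixed volume are now the same spherical integral, of ρ_S^m g. -/
theorem isDualIsoperimetrix_starSet [FiniteDimensional ℝ V] (hV : finrank ℝ V = m + 1)
    {Ω : V [⋀^Fin (m + 1)]→ₗ[ℝ] ℝ} (hΩ : Ω ≠ 0) {g : V → ℝ}
    (hg : IsRadial g) {μ : VolumeAssignment.{u}}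
    (hμ : ∀ p ≠ 0, ∀ v : Fin m → V, quotientDensity μ p v = g p * |Ω (Matrix.vecCons p v)|) :
    IsDualIsoperimetrix μ Ω (starSet g) := by
  refine ⟨isStarBody_starSet hg, fun S hS => ?_⟩
  obtain ⟨b, -, hb⟩ := exists_basis_mul_dualMixedVolume hV hΩ
  rw [dualSurfaceArea_eq_integral b Ω hS hg hμ, hb]
  simp only [radialFunction_starSet hg (sphere_basis_sum_ne_zero b _)]

/-- Coordinates in Euclidean space. -/
def euclideanCoord (b : Basis (Fin (m + 1)) ℝ V) : V ≃L[ℝ] EuclideanSpace ℝ (Fin (m + 1)) :=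
  b.equivFunL.trans (EuclideanSpace.equiv (Fin (m + 1)) ℝ).symm

theorem euclideanCoord_sum (b : Basis (Fin (m + 1)) ℝ V) (x : EuclideanSpace ℝ (Fin (m + 1))) :
    euclideanCoord b (∑ j, x j • b j) = x := by
  have : b.equivFun (∑ j, x j • b j) = fun j => x j := by
    rw [← b.equivFun_symm_apply, LinearEquiv.apply_symm_apply]
  ext j
  exact congrFun this j

theorem euclideanCoord_symm_apply (b : Basis (Fin (m + 1)) ℝ V)
    (x : EuclideanSpace ℝ (Fin (m + 1))) : (euclideanCoord b).symm x = ∑ j, x j • b j := by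
  rw [ContinuousLinearEquiv.symm_apply_eq, euclideanCoord_sum]

/-- The radial function `(1 + ψ(x/|x|))^{1/m} / |x|` in Euclidean coordinates. -/
def bumpRadial (b : Basis (Fin (m + 1)) ℝ V) (ψ : EuclideanSpace ℝ (Fin (m + 1)) → ℝ) (p : V) :
    ℝ :=
  ‖euclideanCoord b p‖⁻¹ *
    (1 + ψ (‖euclideanCoord b p‖⁻¹ • euclideanCoord b p)) ^ ((m : ℝ)⁻¹)

theorem contDiffOn_bumpRadial (b : Basis (Fin (m + 1)) ℝ V)
    {ψ : EuclideanSpace ℝ (Fin (m + 1)) → ℝ} (hψ : ContDiff ℝ (⊤ : ℕ∞) ψ) (h0 : ∀ x, 0 ≤ ψ x) :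
    ContDiffOn ℝ (⊤ : ℕ∞) (bumpRadial b ψ) {0}ᶜ := by
  intro p hp
  have hne : euclideanCoord b p ≠ 0 := fun h => hp ((euclideanCoord b).map_eq_zero_iff.1 h)
  have h1 : ContDiffAt ℝ (⊤ : ℕ∞) (fun p => euclideanCoord b p) p :=
    (euclideanCoord b).contDiff.contDiffAt
  have h2 : ContDiffAt ℝ (⊤ : ℕ∞) (fun p => ‖euclideanCoord b p‖⁻¹) p :=
    (h1.norm ℝ hne).inv (norm_ne_zero_iff.2 hne)
  refine ContDiffAt.contDiffWithinAt (h2.mul (ContDiffAt.rpow_const_of_ne ?_ ?_))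
  · exact contDiffAt_const.add (hψ.contDiffAt.comp p (h2.smul h1))
  · have := h0 (‖euclideanCoord b p‖⁻¹ • euclideanCoord b p)
    positivity

theorem isRadial_bumpRadial (b : Basis (Fin (m + 1)) ℝ V)
    {ψ : EuclideanSpace ℝ (Fin (m + 1)) → ℝ} (hψ : ContDiff ℝ (⊤ : ℕ∞) ψ) (h0 : ∀ x, 0 ≤ ψ x) :
    IsRadial (bumpRadial b ψ) where
  pos p hp := by
    have hne : euclideanCoord b p ≠ 0 := fun h => hp ((euclideanCoord b).map_eq_zero_iff.1 h)
    have := h0 (‖euclideanCoord b p‖⁻¹ • euclideanCoord b p)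
    have h2 := norm_pos_iff.2 hne
    unfold bumpRadial
    positivity
  smul r hr p := by
    have : (r⁻¹ * ‖euclideanCoord b p‖⁻¹) * r = ‖euclideanCoord b p‖⁻¹ := by field_simp
    simp only [bumpRadial, map_smul, norm_smul, Real.norm_of_nonneg hr.le, mul_inv, smul_smul, this]
    ring
  continuousOn := (contDiffOn_bumpRadial b hψ h0).continuousOn

theorem isSmoothStarBody_bumpRadial [FiniteDimensional ℝ V] (b : Basis (Fin (m + 1)) ℝ V)
    {ψ : EuclideanSpace ℝ (Fin (m + 1)) → ℝ} (hψ : ContDiff ℝ (⊤ : ℕ∞) ψ) (h0 : ∀ x, 0 ≤ ψ x) :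
    IsSmoothStarBody (starSet (bumpRadial b ψ)) where
  toIsStarBody := isStarBody_starSet (isRadial_bumpRadial b hψ h0)
  contDiffOn := (contDiffOn_bumpRadial b hψ h0).congr fun _ hp =>
    radialFunction_starSet (isRadial_bumpRadial b hψ h0) hp

/-- The exponent 1/m in `bumpRadial` is chosen for this: ρ_S^m becomes affine in ψ, so the integral
identity can be tested against ψ. For m = 0 the power is always 1 and carries no information. -/
theorem radialFunction_bumpRadial_pow [FiniteDimensional ℝ V] (b : Basis (Fin (m + 1)) ℝ V) (hm : 1 ≤ m)
    {ψ : EuclideanSpace ℝ (Fin (m + 1)) → ℝ} (hψ : ContDiff ℝ (⊤ : ℕ∞) ψ) (h0 : ∀ x, 0 ≤ ψ x)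
    (x : Metric.sphere (0 : EuclideanSpace ℝ (Fin (m + 1))) 1) :
    radialFunction (starSet (bumpRadial b ψ))
      (∑ j, (x : EuclideanSpace ℝ (Fin (m + 1))) j • b j) ^ m = 1 + ψ x := by
  rw [radialFunction_starSet (isRadial_bumpRadial b hψ h0) (sphere_basis_sum_ne_zero b x),
    bumpRadial, euclideanCoord_sum]
  have hx : ‖(x : EuclideanSpace ℝ (Fin (m + 1)))‖ = 1 := by simp
  have := h0 x
  rw [hx, inv_one, one_mul, one_smul, ← Real.rpow_natCast, ← Real.rpow_mul (by positivity),
    inv_mul_cancel₀ (by positivity), Real.rpow_one]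

/-- If f₁ exceeded f₂ at x₀, it would do so on a ball, and a smooth bump supported there would
separate the integrals. Equality comes from using the inequality in both directions. -/
theorem sphere_eq_of_integral_bump_eq
    {f₁ f₂ : Metric.sphere (0 : EuclideanSpace ℝ (Fin (m + 1))) 1 → ℝ}
    (h₁ : Continuous f₁) (h₂ : Continuous f₂)
    (h : ∀ ψ : EuclideanSpace ℝ (Fin (m + 1)) → ℝ, ContDiff ℝ (⊤ : ℕ∞) ψ → (∀ x, 0 ≤ ψ x) →
      ∫ x, ψ x * f₁ x ∂(volume : Measure (EuclideanSpace ℝ (Fin (m + 1)))).toSphere =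
      ∫ x, ψ x * f₂ x ∂(volume : Measure (EuclideanSpace ℝ (Fin (m + 1)))).toSphere)
    (x₀ : Metric.sphere (0 : EuclideanSpace ℝ (Fin (m + 1))) 1) : f₁ x₀ ≤ f₂ x₀ := by
  by_contra! hlt
  obtain ⟨r, hr, hball⟩ := Metric.eventually_nhds_iff_ball.1
    ((isOpen_lt h₂ h₁).mem_nhds (show x₀ ∈ {x | f₂ x < f₁ x} from hlt))
  let ψ : ContDiffBump (x₀ : EuclideanSpace ℝ (Fin (m + 1))) :=
    ⟨r / 2, r, by positivity, by linarith⟩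
  have hψc : Continuous fun x : Metric.sphere (0 : EuclideanSpace ℝ (Fin (m + 1))) 1 =>
      ψ (x : EuclideanSpace ℝ (Fin (m + 1))) := ψ.continuous.comp continuous_subtype_val
  have hint : ∀ f : Metric.sphere (0 : EuclideanSpace ℝ (Fin (m + 1))) 1 → ℝ, Continuous f →
      Integrable (fun x : Metric.sphere (0 : EuclideanSpace ℝ (Fin (m + 1))) 1 =>
        ψ (x : EuclideanSpace ℝ (Fin (m + 1))) * f x)
        (volume : Measure (EuclideanSpace ℝ (Fin (m + 1)))).toSphere := fun f hf =>
    (hψc.mul hf).integrable_of_hasCompactSupport (HasCompactSupport.of_compactSpace _)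
  have hpos : 0 < ∫ x : Metric.sphere (0 : EuclideanSpace ℝ (Fin (m + 1))) 1,
      ψ (x : EuclideanSpace ℝ (Fin (m + 1))) * (f₁ x - f₂ x)
        ∂(volume : Measure (EuclideanSpace ℝ (Fin (m + 1)))).toSphere := by
    refine (hψc.mul (h₁.sub h₂)).integral_pos_of_hasCompactSupport_nonneg_nonzero
      (HasCompactSupport.of_compactSpace _) (fun x => ?_) (x := x₀) ?_
    · by_cases hx : dist (x : EuclideanSpace ℝ (Fin (m + 1))) x₀ < r
      · exact mul_nonneg ψ.nonneg (sub_nonneg.2 (le_of_lt (hball x hx)))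
      · simp [ψ.zero_of_le_dist (not_lt.1 hx)]
    · have h1 : ψ (x₀ : EuclideanSpace ℝ (Fin (m + 1))) = 1 :=
        ψ.one_of_mem_closedBall (Metric.mem_closedBall_self (by positivity))
      simp only [h1, one_mul]
      exact (sub_pos.2 hlt).ne'
  simp only [mul_sub] at hpos
  rw [integral_sub (hint f₁ h₁) (hint f₂ h₂), h ψ ψ.contDiff (fun x => ψ.nonneg), sub_self] at hpos
  exact lt_irrefl _ hpos

theorem IsDualIsoperimetrix.eq_starSet [FiniteDimensional ℝ V] (hV : finrank ℝ V = m + 1)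
    {Ω : V [⋀^Fin (m + 1)]→ₗ[ℝ] ℝ} (hΩ : Ω ≠ 0) {g : V → ℝ}
    (hg : IsRadial g) {μ : VolumeAssignment.{u}}
    (hμ : ∀ p ≠ 0, ∀ v : Fin m → V, quotientDensity μ p v = g p * |Ω (Matrix.vecCons p v)|)
    (hm : 1 ≤ m) {T : Set V} (hT : IsDualIsoperimetrix μ Ω T) : T = starSet g := by
  obtain ⟨b, hΩb, hb⟩ := exists_basis_mul_dualMixedVolume hV hΩ
  have hr := hT.1.isRadial
  set f₁ := fun x : Metric.sphere (0 : EuclideanSpace ℝ (Fin (m + 1))) 1 =>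
    radialFunction T (∑ j, (x : EuclideanSpace ℝ (Fin (m + 1))) j • b j)
  set f₂ := fun x : Metric.sphere (0 : EuclideanSpace ℝ (Fin (m + 1))) 1 =>
    g (∑ j, (x : EuclideanSpace ℝ (Fin (m + 1))) j • b j)
  have h₁ : Continuous f₁ := continuous_sphere_comp hr.continuousOn b
  have h₂ : Continuous f₂ := continuous_sphere_comp hg.continuousOn b
  have hp₁ : ∀ x, 0 < f₁ x := fun x => hr.pos _ (sphere_basis_sum_ne_zero b x)
  have hp₂ : ∀ x, 0 < f₂ x := fun x => hg.pos _ (sphere_basis_sum_ne_zero b x)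
  have hone : ∀ ψ : EuclideanSpace ℝ (Fin (m + 1)) → ℝ, ContDiff ℝ (⊤ : ℕ∞) ψ → (∀ x, 0 ≤ ψ x) →
      ∫ x : Metric.sphere (0 : EuclideanSpace ℝ (Fin (m + 1))) 1, (1 + ψ x) * f₁ x
        ∂(volume : Measure (EuclideanSpace ℝ (Fin (m + 1)))).toSphere =
      ∫ x : Metric.sphere (0 : EuclideanSpace ℝ (Fin (m + 1))) 1, (1 + ψ x) * f₂ x
        ∂(volume : Measure (EuclideanSpace ℝ (Fin (m + 1)))).toSphere := by
    intro ψ hψ h0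
    have hS := isSmoothStarBody_bumpRadial b hψ h0
    have h1 := hT.2 _ hS
    rw [dualSurfaceArea_eq_integral b Ω hS hg hμ, hb] at h1
    simp only [radialFunction_bumpRadial_pow b hm hψ h0] at h1
    have hψ1 : ∀ x, 0 ≤ 1 + ψ x := fun x => add_nonneg zero_le_one (h0 x)
    rw [ENNReal.ofReal_eq_ofReal_iff] at h1
    · exact (mul_left_cancel₀ (abs_pos.2 hΩb).ne' h1).symm
    · exact mul_nonneg (abs_nonneg _) (integral_nonneg fun x => mul_nonneg (hψ1 x) (hp₂ x).le)
    · exact mul_nonneg (abs_nonneg _) (integral_nonneg fun x => mul_nonneg (hψ1 x) (hp₁ x).le)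
  have hbump : ∀ ψ : EuclideanSpace ℝ (Fin (m + 1)) → ℝ, ContDiff ℝ (⊤ : ℕ∞) ψ → (∀ x, 0 ≤ ψ x) →
      ∫ x : Metric.sphere (0 : EuclideanSpace ℝ (Fin (m + 1))) 1, ψ x * f₁ x
        ∂(volume : Measure (EuclideanSpace ℝ (Fin (m + 1)))).toSphere =
      ∫ x : Metric.sphere (0 : EuclideanSpace ℝ (Fin (m + 1))) 1, ψ x * f₂ x
        ∂(volume : Measure (EuclideanSpace ℝ (Fin (m + 1)))).toSphere := by
    intro ψ hψ h0
    have hψc : Continuous fun x : Metric.sphere (0 : EuclideanSpace ℝ (Fin (m + 1))) 1 =>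
      ψ (x : EuclideanSpace ℝ (Fin (m + 1))) := hψ.continuous.comp continuous_subtype_val
    have hint : ∀ f : Metric.sphere (0 : EuclideanSpace ℝ (Fin (m + 1))) 1 → ℝ, Continuous f →
        Integrable f (volume : Measure (EuclideanSpace ℝ (Fin (m + 1)))).toSphere := fun f hf =>
      hf.integrable_of_hasCompactSupport (HasCompactSupport.of_compactSpace _)
    have hψ₁ : Continuous fun x : Metric.sphere (0 : EuclideanSpace ℝ (Fin (m + 1))) 1 =>
      ψ (x : EuclideanSpace ℝ (Fin (m + 1))) * f₁ x := hψc.mul h₁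
    have hψ₂ : Continuous fun x : Metric.sphere (0 : EuclideanSpace ℝ (Fin (m + 1))) 1 =>
      ψ (x : EuclideanSpace ℝ (Fin (m + 1))) * f₂ x := hψc.mul h₂
    have hA := hone ψ hψ h0
    -- The case ψ = 0 is subtracted to remove the constant term of 1 + ψ.
    have hB := hone (fun _ => 0) contDiff_const fun _ => le_rfl
    simp only [add_zero, one_mul] at hB
    simp only [add_mul, one_mul] at hA
    rw [integral_add (hint _ h₁) (hint _ hψ₁), integral_add (hint _ h₂)
      (hint _ hψ₂), hB] at hA
    exact add_left_cancel hA
  have heq : ∀ x, f₁ x = f₂ x := fun x =>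
    le_antisymm (sphere_eq_of_integral_bump_eq h₁ h₂ hbump x)
      (sphere_eq_of_integral_bump_eq h₂ h₁ (fun ψ hψ h0 => (hbump ψ hψ h0).symm) x)
  refine hT.1.eq_starSet_of_radialFunction_eq fun p hp => ?_
  have hne : euclideanCoord b p ≠ 0 := fun h => hp ((euclideanCoord b).map_eq_zero_iff.1 h)
  have hn := norm_pos_iff.2 hne
  -- Homogeneity extends the equality from the Euclidean sphere to every p ≠ 0.
  have h1 := heq ⟨‖euclideanCoord b p‖⁻¹ • euclideanCoord b p, by simp [norm_smul, hn.ne']⟩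
  simp only [f₁, f₂, ← euclideanCoord_symm_apply, map_smul,
    ContinuousLinearEquiv.symm_apply_apply] at h1
  rw [hr.smul _ (inv_pos.2 hn), hg.smul _ (inv_pos.2 hn)] at h1
  exact mul_left_cancel₀ (inv_ne_zero (inv_ne_zero hn.ne')) h1

end Uniqueness

/-! ### Volumes of projections -/

section Fubini

theorem volume_add_Icc {F : Set ℝ} (hc : IsCompact F) (hconv : Convex ℝ F) (hne : F.Nonempty) :
    volume (F + Set.Icc (0 : ℝ) 1) = volume F + 1 := by
  have hF := eq_Icc_of_connected_compact ⟨hne, hconv.isPreconnected⟩ hc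
  obtain ⟨x, hx⟩ := hne
  have hab : sInf F ≤ sSup F := by
    rw [hF] at hx
    exact hx.1.trans hx.2
  set a := sInf F
  set b := sSup F
  rw [hF, Set.Icc_add_Icc hab zero_le_one, Real.volume_Icc, Real.volume_Icc, add_zero,
    show b + 1 - a = b - a + 1 by ring, ENNReal.ofReal_add (sub_nonneg.2 hab) zero_le_one,
    ENNReal.ofReal_one]

/-- Each nonempty fibre of K in the direction of the segment is a compact interval and grows in
length by 1; empty fibres stay empty. Integrating over the base adds the volume of the projection.
-/
theorem volume_prod_add_segment {E : Type*} [NormedAddCommGroup E] [NormedSpace ℝ E]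
    [MeasureSpace E] [BorelSpace E] [SecondCountableTopology E] [SFinite (volume : Measure E)]
    {K : Set (ℝ × E)} (hc : IsCompact K) (hconv : Convex ℝ K) :
    volume (K + Set.Icc (0 : ℝ) 1 ×ˢ {(0 : E)}) = volume K + volume (Prod.snd '' K) := by
  have hc' : IsCompact (K + Set.Icc (0 : ℝ) 1 ×ˢ {(0 : E)}) :=
    hc.add (isCompact_Icc.prod isCompact_singleton)
  have hP : MeasurableSet (Prod.snd '' K) := (hc.image continuous_snd).measurableSet
  rw [Measure.volume_eq_prod, Measure.prod_apply_symm hc'.measurableSet,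
    Measure.prod_apply_symm hc.measurableSet, ← lintegral_indicator_one hP,
    ← lintegral_add_right _ (measurable_one.indicator hP)]
  refine lintegral_congr fun y => ?_
  have hfib : (fun t : ℝ => (t, y)) ⁻¹' (K + Set.Icc (0 : ℝ) 1 ×ˢ {(0 : E)}) =
      (fun t : ℝ => (t, y)) ⁻¹' K + Set.Icc (0 : ℝ) 1 := by
    ext t
    simp only [Set.mem_preimage, Set.mem_add, Set.mem_prod, Set.mem_singleton_iff, Prod.exists]
    constructor
    · rintro ⟨s, z, hs, r, w, ⟨hr, rfl⟩, h⟩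
      simp only [Prod.mk_add_mk, add_zero, Prod.mk.injEq] at h
      exact ⟨s, h.2 ▸ hs, r, hr, h.1⟩
    · rintro ⟨s, hs, r, hr, h⟩
      exact ⟨s, y, hs, r, 0, ⟨hr, rfl⟩, by simp [h]⟩
  rw [hfib]
  by_cases hy : y ∈ Prod.snd '' K
  · rw [Set.indicator_of_mem hy]
    refine volume_add_Icc ?_ ?_ ?_
    · exact (hc.image continuous_fst).of_isClosed_subset
        (hc.isClosed.preimage (by fun_prop : Continuous fun t : ℝ => (t, y)))
        fun t ht => ⟨_, ht, rfl⟩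
    · intro s hs t ht a b ha hb hab
      have := hconv hs ht ha hb hab
      simpa [← add_smul, hab] using this
    · obtain ⟨⟨t, y'⟩, h, rfl⟩ := hy
      exact ⟨t, h⟩
  · have : (fun t : ℝ => (t, y)) ⁻¹' K = ∅ := by
      ext t
      simp only [Set.mem_preimage, Set.mem_empty_iff_false, iff_false]
      exact fun h => hy ⟨_, h, rfl⟩
    rw [this, Set.indicator_of_notMem hy, Set.empty_add]
    simp

end Fubini

/-! ### The support function of the projection body and the Busemann density -/

section Shadow

variable {V : Type*} [NormedAddCommGroup V] [NormedSpace ℝ V] {m : ℕ}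

theorem coordVol_mkQ_image (v : V) (x : Fin m → V) (K : Set V) :
    coordVol (fun i => (Submodule.span ℝ {v}).mkQ (x i)) ((Submodule.span ℝ {v}).mkQ '' K) =
      (volume {y : Fin m → ℝ | ∃ t : ℝ, t • v + ∑ i, y i • x i ∈ K}).toReal := by
  unfold coordVol
  congr 2
  ext y
  simp only [Set.mem_ofPred_eq, ← map_smul, ← map_sum, Set.mem_image]
  constructor
  · rintro ⟨k, hk, h⟩
    obtain ⟨t, ht⟩ := Submodule.mem_span_singleton.1
      ((Submodule.Quotient.eq (Submodule.span ℝ {v})).1 h)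
    exact ⟨t, by rwa [ht, sub_add_cancel]⟩
  · rintro ⟨t, ht⟩
    refine ⟨_, ht, ?_⟩
    rw [map_add, map_smul]
    simp [Submodule.mem_span_singleton_self]

/-- In coordinates with v as first basis vector, the segment is [0, 1] × {0} and the quotient map
forgets the first coordinate, so the product case applies. -/
theorem coordVol_add_segment {v : V} (c : Basis (Fin (m + 1)) ℝ V) (hc : c 0 = v) {K : Set V}
    (hK : IsCompact K) (hconv : Convex ℝ K) :
    coordVol c (K + segment ℝ 0 v) = coordVol c K +
      coordVol (fun i : Fin m => (Submodule.span ℝ {v}).mkQ (c i.succ))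
        ((Submodule.span ℝ {v}).mkQ '' K) := by
  have : FiniteDimensional ℝ V := c.finiteDimensional_of_finite
  let e := MeasurableEquiv.piFinSuccAbove (fun _ : Fin (m + 1) => ℝ) 0
  have he : ∀ z : Fin (m + 1) → ℝ, e z = (z 0, fun i => z i.succ) := fun z => by
    ext i
    · simp [e, MeasurableEquiv.piFinSuccAbove]
    · simp [e, MeasurableEquiv.piFinSuccAbove, Fin.insertNthEquiv, Fin.tail]
  let f : ℝ × (Fin m → ℝ) → V := fun p => p.1 • v + ∑ i, p.2 i • c i.succ
  have hf : ∀ z, f (e z) = ∑ j, z j • c j := fun z => by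
    rw [he, Fin.sum_univ_succ, hc]
  have hvol : ∀ A : Set V, volume {z : Fin (m + 1) → ℝ | ∑ j, z j • c j ∈ A} = volume (f ⁻¹' A) := by
    intro A
    rw [← (volume_preserving_piFinSuccAbove (fun _ : Fin (m + 1) => ℝ) 0).measure_preimage_equiv]
    congr 1
    ext z
    change _ ↔ f (e z) ∈ A
    rw [hf]
    rfl
  let L : (ℝ × (Fin m → ℝ)) →ₗ[ℝ] V :=
    { toFun := f
      map_add' := fun p q => by
        simp only [f, Prod.fst_add, Prod.snd_add, Pi.add_apply, add_smul, Finset.sum_add_distrib]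
        abel
      map_smul' := fun r p => by
        simp [f, mul_smul, Finset.smul_sum] }
  have hinj : Function.Injective f := fun p q h => by
    have h1 : e.symm p = e.symm q := by
      refine c.equivFun.symm.injective ?_
      rw [c.equivFun_symm_apply, c.equivFun_symm_apply, ← hf, ← hf, e.apply_symm_apply,
        e.apply_symm_apply, h]
    exact e.symm.injective h1
  have hsurj : Function.Surjective f := fun w => by
    refine ⟨e (c.equivFun w), ?_⟩
    rw [hf, c.sum_equivFun]
  let Le : (ℝ × (Fin m → ℝ)) ≃L[ℝ] V :=
    (LinearEquiv.ofBijective L ⟨hinj, hsurj⟩).toContinuousLinearEquiv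
  have hcomp : IsCompact (f ⁻¹' K) := Le.toHomeomorph.isCompact_preimage.2 hK
  have hcv : Convex ℝ (f ⁻¹' K) := hconv.linear_preimage L
  have hsum : f ⁻¹' (K + segment ℝ 0 v) = f ⁻¹' K + Set.Icc (0 : ℝ) 1 ×ˢ {(0 : Fin m → ℝ)} := by
    have hfs : ∀ t : ℝ, f (t, 0) = t • v := fun t => by simp [f]
    ext p
    simp only [Set.mem_preimage, Set.mem_add, segment_eq_image, Set.mem_image, Set.mem_prod,
      Set.mem_singleton_iff, Prod.exists]
    constructor
    · rintro ⟨k, hk, _, ⟨t, ht, rfl⟩, h⟩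
      refine ⟨p.1 - t, p.2, ?_, t, 0, ⟨ht, rfl⟩, by simp⟩
      have h2 : f (p.1 - t, p.2) = k := by
        have h3 : f p = f (p.1 - t, p.2) + f (t, 0) := by
          rw [← show L _ + L _ = f (p.1 - t, p.2) + f (t, 0) from rfl, ← map_add]
          simp [L]
        rw [← h, hfs] at h3
        simpa using h3.symm
      rwa [h2]
    · rintro ⟨s, y, hk, t, z, ⟨ht, rfl⟩, rfl⟩
      refine ⟨f (s, y), hk, t • v, ⟨t, ht, by simp⟩, ?_⟩
      rw [← hfs]
      exact (L.map_add (s, y) (t, 0)).symm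
  have hfin : volume (f ⁻¹' K) ≠ ∞ := hcomp.measure_lt_top.ne
  have hfin' : volume (Prod.snd '' (f ⁻¹' K)) ≠ ∞ := (hcomp.image continuous_snd).measure_lt_top.ne
  have himg : {y : Fin m → ℝ | ∃ t : ℝ, t • v + ∑ i, y i • c i.succ ∈ K} =
      Prod.snd '' (f ⁻¹' K) := by
    ext y
    simp [f]
  rw [coordVol_mkQ_image, himg, coordVol, coordVol, hvol, hvol, hsum,
    volume_prod_add_segment hcomp hcv, ENNReal.toReal_add hfin hfin']

theorem formVol_add_segment [FiniteDimensional ℝ V] (hV : finrank ℝ V = m + 1)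
    {Ω : V [⋀^Fin (m + 1)]→ₗ[ℝ] ℝ} (hΩ : Ω ≠ 0) {v : V} (hv : v ≠ 0) {K : Set V}
    (hK : IsCompact K) (hconv : Convex ℝ K) :
    formVol Ω (K + segment ℝ 0 v) = formVol Ω K +
      formVol (contraction Ω v) ((Submodule.span ℝ {v}).mkQ '' K) := by
  obtain ⟨c, hc⟩ := exists_basis_zero_eq hV hv
  have h0 := apply_basis_ne_zero hΩ c
  have hcc := basis_eq_vecCons c hc
  rw [formVol_eq Ω c, formVol_eq Ω c, coordVol_add_segment c hc hK hconv,
    formVol_contraction hV hΩ hv (x := fun i => c i.succ) (by rwa [← hcc]), ← hcc]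
  ring

theorem formVol_contraction_smul [FiniteDimensional ℝ V] (hV : finrank ℝ V = m + 1)
    {Ω : V [⋀^Fin (m + 1)]→ₗ[ℝ] ℝ} (hΩ : Ω ≠ 0) {v : V} (hv : v ≠ 0) {r : ℝ} (hr : r ≠ 0)
    (K : Set V) :
    formVol (contraction Ω (r • v)) ((Submodule.span ℝ {r • v}).mkQ '' K) =
      |r| * formVol (contraction Ω v) ((Submodule.span ℝ {v}).mkQ '' K) := by
  obtain ⟨c, hc⟩ := exists_basis_zero_eq hV hv
  have h0 := apply_basis_ne_zero hΩ c
  rw [basis_eq_vecCons c hc] at h0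
  have hsm : Ω (Matrix.vecCons (r • v) fun i => c i.succ) =
      r * Ω (Matrix.vecCons v fun i => c i.succ) := by
    rw [← AlternatingMap.curryLeft_apply_apply, map_smul]
    rfl
  rw [formVol_contraction hV hΩ hv h0, formVol_contraction hV hΩ (smul_ne_zero hr hv)
    (x := fun i => c i.succ) (by rw [hsm]; exact mul_ne_zero hr h0), hsm, coordVol_mkQ_image,
    coordVol_mkQ_image, abs_mul, mul_assoc]
  congr 5
  ext y
  constructor
  · rintro ⟨t, ht⟩
    exact ⟨t * r, by rwa [mul_smul]⟩
  · rintro ⟨t, ht⟩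
    exact ⟨t / r, by rwa [smul_smul, div_mul_cancel₀ _ hr]⟩

/-- The quotient norm is attained: a nearest point of the line exists in finite dimension. Hence the
closed ball maps onto the closed ball. -/
theorem mkQ_image_closedBall [FiniteDimensional ℝ V] (v : V) :
    (Submodule.span ℝ {v}).mkQ '' Metric.closedBall (0 : V) 1 =
      Metric.closedBall (0 : V ⧸ Submodule.span ℝ {v}) 1 := by
  have : ProperSpace V := FiniteDimensional.proper ℝ V
  ext q
  simp only [Set.mem_image, mem_closedBall_zero_iff]
  constructor
  · rintro ⟨x, hx, rfl⟩
    exact (Submodule.Quotient.norm_mk_le _ x).trans hx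
  · intro hq
    obtain ⟨x, rfl⟩ := Submodule.mkQ_surjective _ q
    have hcl : IsClosed (Submodule.span ℝ {v} : Set V) := isClosed_line v
    obtain ⟨s, hs, hd⟩ := hcl.exists_infDist_eq_dist ⟨0, Submodule.zero_mem _⟩ x
    refine ⟨x - s, ?_, ?_⟩
    · rw [← dist_eq_norm, ← hd]
      exact (QuotientAddGroup.norm_mk (S := (Submodule.span ℝ {v}).toAddSubgroup) x).symm.trans_le hq
    · rw [map_sub, sub_eq_self]
      simpa using hs

/-- The support function of the projection body of the unit ball. -/
def shadow (Ω : V [⋀^Fin (m + 1)]→ₗ[ℝ] ℝ) (v : V) : ℝ :=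
  formVol (contraction Ω v) ((Submodule.span ℝ {v}).mkQ '' Metric.closedBall (0 : V) 1)

variable [FiniteDimensional ℝ V] (hV : finrank ℝ V = m + 1) {Ω : V [⋀^Fin (m + 1)]→ₗ[ℝ] ℝ}
  (hΩ : Ω ≠ 0)

include hV hΩ in
theorem exists_apply_vecCons_ne_zero {v : V} (hv : v ≠ 0) :
    ∃ x : Fin m → V, Ω (Matrix.vecCons v x) ≠ 0 := by
  obtain ⟨c, hc⟩ := exists_basis_zero_eq hV hv
  exact ⟨_, by rw [← basis_eq_vecCons c hc]; exact apply_basis_ne_zero hΩ c⟩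

include hV hΩ in
theorem shadow_pos {v : V} (hv : v ≠ 0) : 0 < shadow Ω v := by
  obtain ⟨x, hx⟩ := exists_apply_vecCons_ne_zero hV hΩ hv
  rw [shadow, formVol_contraction hV hΩ hv hx, mkQ_image_closedBall]
  exact mul_pos (abs_pos.2 hx)
    (coordVol_closedBall_pos ((linearIndependent_mkQ_iff hV hΩ hv x).2 hx))

omit [FiniteDimensional ℝ V] in
theorem shadow_zero : shadow Ω 0 = 0 := by
  have : contraction Ω 0 = 0 := by
    unfold contraction
    rw [map_zero]
    rfl
  -- At v = 0 the contracted form is zero, and `formVol` takes its default value 0, so homogeneity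
  -- and subadditivity hold there too.
  rw [shadow, this, formVol, dif_neg]
  simp

include hV hΩ in
theorem shadow_smul (r : ℝ) (v : V) : shadow Ω (r • v) = |r| * shadow Ω v := by
  by_cases hv : v = 0
  · rw [hv, smul_zero, shadow_zero, mul_zero]
  by_cases hr : r = 0
  · rw [hr, zero_smul, shadow_zero, abs_zero, zero_mul]
  exact formVol_contraction_smul hV hΩ hv hr _

include hV hΩ in
-- Adding a segment [0, w] to a convex body enlarges its volume by that of its projection along w.
-- As [0, ε(u + v)] ⊆ [0, εu] + [0, εv], comparing the volumes of the enlarged balls to first order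
-- in ε gives subadditivity.
theorem shadow_add_le (u v : V) : shadow Ω (u + v) ≤ shadow Ω u + shadow Ω v := by
  have : ProperSpace V := FiniteDimensional.proper ℝ V
  by_cases hu : u = 0
  · rw [hu, zero_add, shadow_zero, zero_add]
  by_cases hv : v = 0
  · rw [hv, add_zero, shadow_zero, add_zero]
  by_cases huv : u + v = 0
  · rw [huv, shadow_zero]
    exact add_nonneg (shadow_pos hV hΩ hu).le (shadow_pos hV hΩ hv).le
  have hB : IsCompact (Metric.closedBall (0 : V) 1) := isCompact_closedBall 0 1
  have hBc : Convex ℝ (Metric.closedBall (0 : V) 1) := convex_closedBall 0 1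
  have hseg : ∀ w : V, IsCompact (segment ℝ 0 w) := fun w => by
    rw [segment_eq_image]
    exact isCompact_Icc.image (by fun_prop)
  have key : ∀ ε : ℝ, 0 < ε →
      shadow Ω (u + v) ≤ shadow Ω u + (1 + ε * ‖u‖) ^ m * shadow Ω v := by
    intro ε hε
    have h1 : formVol Ω (Metric.closedBall (0 : V) 1 + segment ℝ 0 (ε • (u + v))) ≤
        formVol Ω (Metric.closedBall (0 : V) 1 + segment ℝ 0 (ε • u) + segment ℝ 0 (ε • v)) := by
      let b := finBasisOfFinrankEq ℝ V hV
      rw [formVol_eq Ω b, formVol_eq Ω b]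
      refine mul_le_mul_of_nonneg_left (coordVol_mono b.linearIndependent
        ((hB.add (hseg _)).add (hseg _)).isBounded ?_) (abs_nonneg _)
      rw [add_assoc]
      refine Set.add_subset_add_left ?_
      rw [segment_eq_image, segment_eq_image, segment_eq_image]
      rintro _ ⟨t, ht, rfl⟩
      exact ⟨_, ⟨t, ht, rfl⟩, _, ⟨t, ht, rfl⟩, by simp [smul_add]⟩
    rw [formVol_add_segment hV hΩ (smul_ne_zero hε.ne' huv) hB hBc,
      formVol_add_segment hV hΩ (smul_ne_zero hε.ne' hv) (hB.add (hseg _))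
        (hBc.add (convex_segment _ _)),
      formVol_add_segment hV hΩ (smul_ne_zero hε.ne' hu) hB hBc,
      formVol_contraction_smul hV hΩ huv hε.ne', formVol_contraction_smul hV hΩ hu hε.ne',
      formVol_contraction_smul hV hΩ hv hε.ne', abs_of_pos hε] at h1
    -- The second segment is added to B + [0, εu] rather than to B. This body lies in (1 + ε‖u‖)B,
    -- and volume in the m-dimensional quotient scales by the m-th power.
    have h2 : formVol (contraction Ω v) ((Submodule.span ℝ {v}).mkQ ''
        (Metric.closedBall (0 : V) 1 + segment ℝ 0 (ε • u))) ≤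
        (1 + ε * ‖u‖) ^ m * shadow Ω v := by
      have hR : 0 < 1 + ε * ‖u‖ := by positivity
      obtain ⟨x, hx⟩ := exists_apply_vecCons_ne_zero hV hΩ hv
      have hli := (linearIndependent_mkQ_iff hV hΩ hv x).2 hx
      rw [shadow, formVol_contraction hV hΩ hv hx, formVol_contraction hV hΩ hv hx,
        mul_left_comm]
      refine mul_le_mul_of_nonneg_left ?_ (abs_nonneg _)
      have h3 := coordVol_smul (fun i => (Submodule.span ℝ {v}).mkQ (x i))
        ((Submodule.span ℝ {v}).mkQ '' Metric.closedBall (0 : V) 1) hR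
      rw [Fintype.card_fin] at h3
      rw [← h3]
      refine coordVol_mono hli ?_ ?_
      · rw [mkQ_image_closedBall]
        exact Metric.isBounded_closedBall.smul₀ _
      · rw [← image_smul_set]
        refine Set.image_mono ?_
        rw [smul_closedBall _ _ zero_le_one, smul_zero, mul_one, Real.norm_of_nonneg hR.le]
        rintro _ ⟨a, ha, s, hs, rfl⟩
        rw [segment_eq_image] at hs
        obtain ⟨t, ht, rfl⟩ := hs
        rw [mem_closedBall_zero_iff] at ha ⊢
        refine (norm_add_le _ _).trans (add_le_add ha ?_)
        simp only [smul_zero, zero_add, norm_smul, Real.norm_of_nonneg ht.1,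
          Real.norm_of_nonneg hε.le]
        exact mul_le_of_le_one_left (by positivity) ht.2
    have h3 : ε * shadow Ω (u + v) ≤ ε * (shadow Ω u + (1 + ε * ‖u‖) ^ m * shadow Ω v) := by
      have := mul_le_mul_of_nonneg_left h2 hε.le
      change _ + ε * shadow Ω (u + v) ≤ _ + ε * shadow Ω u + _ at h1
      linarith
    exact le_of_mul_le_mul_left h3 hε
  have hlim : Filter.Tendsto (fun ε : ℝ => shadow Ω u + (1 + ε * ‖u‖) ^ m * shadow Ω v)
      (nhdsWithin 0 (Set.Ioi 0)) (nhds (shadow Ω u + shadow Ω v)) := by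
    have : Continuous fun ε : ℝ => shadow Ω u + (1 + ε * ‖u‖) ^ m * shadow Ω v := by fun_prop
    have h := this.tendsto 0
    simp only [zero_mul, add_zero, one_pow, one_mul] at h
    exact h.mono_left nhdsWithin_le_nhds
  exact ge_of_tendsto hlim (by filter_upwards [self_mem_nhdsWithin] with ε hε using key ε hε)

include hV hΩ in
-- A finite sublinear function is convex, hence continuous in finite dimension.
theorem continuous_shadow : Continuous (shadow Ω) := by
  have h : ConvexOn ℝ Set.univ (shadow Ω) := by
    refine ⟨convex_univ, fun x _ y _ a b ha hb _ => ?_⟩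
    refine (shadow_add_le hV hΩ _ _).trans ?_
    rw [shadow_smul hV hΩ, shadow_smul hV hΩ, abs_of_nonneg ha, abs_of_nonneg hb]
    rfl
  exact continuousOn_univ.1 (h.continuousOn isOpen_univ)

include hV hΩ in
theorem isRadial_shadow_inv : IsRadial fun x => (shadow Ω x)⁻¹ where
  pos x hx := inv_pos.2 (shadow_pos hV hΩ hx)
  smul r hr x := by rw [shadow_smul hV hΩ, abs_of_pos hr, mul_inv]
  continuousOn := (continuous_shadow hV hΩ).continuousOn.inv₀ fun x hx => (shadow_pos hV hΩ hx).ne'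

include hV hΩ in
-- One inclusion is immediate. For the other, Hahn–Banach extends t • x ↦ t h(x), dominated by the
-- sublinear h = `shadow Ω`, to a functional in ΠB with value h(x) at x; the polar condition tested
-- on it gives h(x) ≤ 1.
theorem polarProjectionBody_closedBall :
    polarProjectionBody Ω (Metric.closedBall (0 : V) 1) = starSet fun x => (shadow Ω x)⁻¹ := by
  ext x
  simp only [polarProjectionBody, Set.mem_preimage, polarBody, Set.mem_ofPred_eq, Dual.eval_apply,
    starSet]
  by_cases hx : x = 0
  · simp [hx]
  simp only [hx, false_or]
  rw [one_le_inv₀ (shadow_pos hV hΩ hx)]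
  constructor
  · intro h
    by_contra! hlt
    let f : V →ₗ.[ℝ] ℝ := LinearPMap.mkSpanSingleton x (shadow Ω x) hx
    obtain ⟨ξ, hξ, hle⟩ := exists_extension_of_le_sublinear f (shadow Ω)
      (fun c hc y => by rw [shadow_smul hV hΩ, abs_of_pos hc]) (shadow_add_le hV hΩ) (by
        rintro ⟨y, hy⟩
        obtain ⟨t, rfl⟩ := Submodule.mem_span_singleton.1 hy
        have : f ⟨t • x, hy⟩ = t • shadow Ω x := 
          LinearPMap.mkSpanSingleton'_apply x (shadow Ω x) _ t hy
        rw [this, shadow_smul hV hΩ, smul_eq_mul]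
        exact mul_le_mul_of_nonneg_right (le_abs_self t) (shadow_pos hV hΩ hx).le)
    have h1 : ξ x = shadow Ω x := by
      have := hξ ⟨x, Submodule.mem_span_singleton_self x⟩
      rw [this]
      exact LinearPMap.mkSpanSingleton_apply ℝ ℝ hx _
    have h2 := h ξ fun v _ => hle v
    rw [h1] at h2
    exact absurd h2 (not_le.2 hlt)
  · intro h ξ hξ
    exact (hξ x hx).trans h

include hV hΩ in
theorem normWithBallVolume_mkQ {p : V} (hp : p ≠ 0) (a : ℝ) (v : Fin m → V) :
    normWithBallVolume a (fun i => (Submodule.span ℝ {p}).mkQ (v i)) =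
      a * (shadow Ω p)⁻¹ * |Ω (Matrix.vecCons p v)| := by
  have hiff := linearIndependent_mkQ_iff hV hΩ hp v
  unfold normWithBallVolume
  split_ifs with h
  · have h0 := hiff.1 h
    have h1 := coordVol_closedBall_pos h
    rw [shadow, formVol_contraction hV hΩ hp h0, mkQ_image_closedBall]
    have := abs_pos.2 h0
    field_simp
  · rw [not_not.1 (mt hiff.2 h), abs_zero, mul_zero]

include hV hΩ in
theorem quotientDensity_busemann {p : V} (hp : p ≠ 0) (v : Fin m → V) :
    quotientDensity busemann p v = ballVol m * (shadow Ω p)⁻¹ * |Ω (Matrix.vecCons p v)| := by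
  rw [← normWithBallVolume_mkQ hV hΩ hp, quotientDensity, busemann, finrank_quotient_line hV hp]

end Shadow

/-! ### Volumes of sections of the polar body -/

section Continuity

/-- Near p₀ the vectors ∑ y_i F(p)_i and ∑ y_i F(p₀)_i differ by at most ε(p) times the norm of the
latter. So the coordinate ball at p lies between those at p₀ of radii (1 + ε)⁻¹ and (1 - ε)⁻¹, and
the volumes are squeezed. -/
theorem continuousAt_coordVol_closedBall {X E : Type*} [TopologicalSpace X] [NormedAddCommGroup E]
    [NormedSpace ℝ E] {m : ℕ} {F : X → Fin m → E} {p₀ : X} (hF : ContinuousAt F p₀)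
    (hli : LinearIndependent ℝ (F p₀)) :
    ContinuousAt (fun p => coordVol (F p) (Metric.closedBall (0 : E) 1)) p₀ := by
  obtain ⟨C, hC, hCb⟩ := exists_norm_le_mul_norm_sum hli
  set ε : X → ℝ := fun p => C * ∑ i, ‖F p i - F p₀ i‖ with hε
  have hεc : Filter.Tendsto ε (nhds p₀) (nhds 0) := by
    have h1 : ContinuousAt ε p₀ := by
      refine continuousAt_const.mul (tendsto_finsetSum _ fun i _ => ?_)
      exact ((continuousAt_pi.1 hF i).sub continuousAt_const).norm
    have h2 : ε p₀ = 0 := by simp [hε]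
    rw [← h2]
    exact h1
  have hε0 : ∀ p, 0 ≤ ε p := fun p => by positivity
  have hdiff : ∀ p (y : Fin m → ℝ), ‖∑ i, y i • F p i - ∑ i, y i • F p₀ i‖ ≤
      ε p * ‖∑ i, y i • F p₀ i‖ := by
    intro p y
    rw [← Finset.sum_sub_distrib]
    refine (norm_sum_le _ _).trans ?_
    calc ∑ i, ‖y i • F p i - y i • F p₀ i‖ ≤ ∑ i, ‖y‖ * ‖F p i - F p₀ i‖ := by
          refine Finset.sum_le_sum fun i _ => ?_
          rw [← smul_sub, norm_smul]
          exact mul_le_mul_of_nonneg_right (norm_le_pi_norm y i) (norm_nonneg _)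
      _ = ‖y‖ * ∑ i, ‖F p i - F p₀ i‖ := by rw [Finset.mul_sum]
      _ ≤ (C * ‖∑ i, y i • F p₀ i‖) * ∑ i, ‖F p i - F p₀ i‖ :=
          mul_le_mul_of_nonneg_right (hCb y) (by positivity)
      _ = ε p * ‖∑ i, y i • F p₀ i‖ := by rw [hε]; ring
  set v₀ := coordVol (F p₀) (Metric.closedBall (0 : E) 1) with hv₀
  have hscale : ∀ r : ℝ, 0 < r → coordVol (F p₀) (Metric.closedBall (0 : E) r) = r ^ m * v₀ := by
    intro r hr
    have := coordVol_smul (F p₀) (Metric.closedBall (0 : E) 1) hr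
    rwa [smul_closedBall _ _ zero_le_one, smul_zero, mul_one, Real.norm_of_nonneg hr.le,
      Fintype.card_fin] at this
  have hupper : ∀ᶠ p in nhds p₀, ε p < 1 := hεc.eventually (gt_mem_nhds one_pos)
  have hsub : ∀ p, ε p < 1 →
      {y : Fin m → ℝ | ∑ i, y i • F p i ∈ Metric.closedBall (0 : E) 1} ⊆
      {y : Fin m → ℝ | ∑ i, y i • F p₀ i ∈ Metric.closedBall (0 : E) (1 - ε p)⁻¹} := by
    intro p hp y hy
    simp only [Set.mem_ofPred_eq, mem_closedBall_zero_iff] at hy ⊢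
    have h1 := hdiff p y
    have h2 := norm_sub_norm_le (∑ i, y i • F p₀ i) (∑ i, y i • F p i)
    rw [norm_sub_rev] at h2
    rw [← one_div, le_div_iff₀ (by linarith)]
    linarith
  refine tendsto_of_tendsto_of_tendsto_of_le_of_le' (g := fun p => ((1 + ε p)⁻¹) ^ m * v₀)
    (h := fun p => ((1 - ε p)⁻¹) ^ m * v₀) ?_ ?_ ?_ ?_
  · have := (((tendsto_const_nhds (x := (1 : ℝ))).add hεc).inv₀ (by norm_num)).pow m
    simpa using this.mul_const v₀
  · have := (((tendsto_const_nhds (x := (1 : ℝ))).sub hεc).inv₀ (by norm_num)).pow m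
    simpa using this.mul_const v₀
  · filter_upwards [hupper] with p hp
    rw [← hscale _ (inv_pos.2 (by linarith [hε0 p]))]
    refine ENNReal.toReal_mono ?_ (measure_mono fun y hy => ?_)
    · exact ((measure_mono (hsub p hp)).trans_lt
        (volume_coord_lt_top hli Metric.isBounded_closedBall)).ne
    · simp only [Set.mem_ofPred_eq, mem_closedBall_zero_iff] at hy ⊢
      have h1 := hdiff p y
      have h2 := norm_sub_norm_le (∑ i, y i • F p i) (∑ i, y i • F p₀ i)
      rw [← one_div, le_div_iff₀ (by linarith [hε0 p])] at hy
      linarith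
  · filter_upwards [hupper] with p hp
    rw [← hscale _ (inv_pos.2 (by linarith))]
    exact ENNReal.toReal_mono (volume_coord_lt_top hli Metric.isBounded_closedBall).ne
      (measure_mono (hsub p hp))

end Continuity

/-! ### The dual volume form and its restriction to hyperplanes -/

section DualForm

variable {V : Type*} [AddCommGroup V] [Module ℝ V] [FiniteDimensional ℝ V]

theorem dualForm_apply {k : ℕ} {Ω : V [⋀^Fin k]→ₗ[ℝ] ℝ} (hΩ : Ω ≠ 0) (c : Basis (Fin k) ℝ V)
    (ξ : Fin k → Dual ℝ V) :
    dualForm Ω ξ = (Ω c)⁻¹ * (Matrix.of fun i j => ξ i (c j)).det := by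
  have hk : finrank ℝ V = k := by simpa using finrank_eq_card_basis c
  have h : ∃ b, Ω b ≠ 0 := ⟨c, apply_basis_ne_zero hΩ c⟩
  rw [dualForm, dif_pos h]
  obtain ⟨b, hb⟩ := exists_basis_of_apply_ne_zero hk h.choose_spec
  rw [← hb]
  have hmat : (Matrix.of fun i j => ξ i (c j)) =
      (Matrix.of fun i j => ξ i (b j)) * b.toMatrix c := by
    ext i j
    rw [Matrix.mul_apply, Matrix.of_apply]
    conv_lhs => rw [← b.sum_toMatrix_smul_self c j, map_sum]
    refine Finset.sum_congr rfl fun l _ => ?_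
    rw [map_smul, smul_eq_mul, mul_comm, Matrix.of_apply]
  have hΩc : Ω c = Ω b * b.det c := by
    conv_lhs => rw [Ω.eq_smul_basis_det b]
    rfl
  have hdet : b.det c ≠ 0 := fun h0 => apply_basis_ne_zero hΩ c (by rw [hΩc, h0, mul_zero])
  rw [hmat, Matrix.det_mul, ← Basis.det_apply, hΩc]
  have h1 : ((Ω b)⁻¹ • (Matrix.detRowAlternating (R := ℝ) (n := Fin k)).compLinearMap
      (LinearMap.pi fun j => Dual.eval ℝ V (b j))) ξ =
      (Ω b)⁻¹ * (Matrix.of fun i j => ξ i (b j)).det := rfl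
  rw [h1]
  field_simp

variable {m : ℕ}

omit [FiniteDimensional ℝ V] in
theorem formVol_submodule {H : Submodule ℝ V} [FiniteDimensional ℝ H] (hH : finrank ℝ H = m)
    (θ : H [⋀^Fin m]→ₗ[ℝ] ℝ)
    {x : Fin m → V} (hx : LinearIndependent ℝ x) (hmem : ∀ i, x i ∈ H) (K : Set V) :
    formVol θ {y : H | (y : V) ∈ K} = |θ fun i => ⟨x i, hmem i⟩| * coordVol x K := by
  have hli : LinearIndependent ℝ fun i => (⟨x i, hmem i⟩ : H) :=
    LinearIndependent.of_comp H.subtype hx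
  obtain ⟨b, hb⟩ := exists_basis_coe_eq hli (by simp [hH])
  rw [formVol_eq θ b, hb]
  congr 1
  unfold coordVol
  congr 2
  ext y
  simp

/-- The ξ_i form a basis of the annihilator of p, dual to the x_j. The restricted form takes the
value 1/Ω(p, x) on it. -/
theorem formVol_restrictedForm_dualForm (hV : finrank ℝ V = m + 1)
    {Ω : V [⋀^Fin (m + 1)]→ₗ[ℝ] ℝ} (hΩ : Ω ≠ 0) {p : V} {x : Fin m → V}
    (hx : Ω (Matrix.vecCons p x) ≠ 0) {ξ : Fin m → Dual ℝ V} (h0 : ∀ i, ξ i p = 0)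
    (h1 : ∀ i j, ξ i (x j) = if i = j then 1 else 0) (K : Set (Dual ℝ V)) :
    formVol (restrictedForm (dualForm Ω) (Dual.eval ℝ V p))
      {η : LinearMap.ker (Dual.eval ℝ V p) | (η : Dual ℝ V) ∈ K} =
      |Ω (Matrix.vecCons p x)|⁻¹ * coordVol ξ K := by
  obtain ⟨c, hc⟩ := exists_basis_of_apply_ne_zero hV hx
  have hp : p ≠ 0 := by
    rintro rfl
    exact hx (Ω.map_coord_zero 0 rfl)
  have hpe : Dual.eval ℝ V p ≠ 0 := fun h => hp ((Module.eval_apply_eq_zero_iff ℝ p).1 h)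
  have hli : LinearIndependent ℝ ξ := by
    rw [Fintype.linearIndependent_iff]
    intro g hg j
    have h2 := congrArg (fun η : Dual ℝ V => η (x j)) hg
    simpa [h1] using h2
  have hrank : finrank ℝ (LinearMap.ker (Dual.eval ℝ V p)) = m := by
    have h2 := LinearMap.finrank_range_add_finrank_ker (Dual.eval ℝ V p)
    rw [LinearMap.range_eq_top.2 (LinearMap.surjective hpe), finrank_top,
      Subspace.dual_finrank_eq, hV, finrank_self] at h2
    omega
  have hw : ∃ w, Dual.eval ℝ V p w = 1 := LinearMap.surjective hpe 1
  have hval : restrictedForm (dualForm Ω) (Dual.eval ℝ V p)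
      (fun i => (⟨ξ i, h0 i⟩ : LinearMap.ker (Dual.eval ℝ V p))) = (Ω (Matrix.vecCons p x))⁻¹ := by
    rw [restrictedForm, dif_pos hw]
    change dualForm Ω (Matrix.vecCons hw.choose ξ) = _
    obtain ⟨w, hη, hw'⟩ : ∃ w : Dual ℝ V, w p = 1 ∧ hw.choose = w := ⟨_, hw.choose_spec, rfl⟩
    rw [hw']
    rw [dualForm_apply hΩ c, hc, Matrix.det_succ_column_zero, Fin.sum_univ_succ]
    -- The column of p is (1, 0, …, 0) and the complementary minor is the identity, so the
    -- determinant is 1 whatever w does on the x_j.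
    have hsub : ((Matrix.of fun i j => Matrix.vecCons w ξ i (Matrix.vecCons p x j)).submatrix
        (Fin.succAbove 0) Fin.succ) = 1 := by
      ext i j
      simp [h1, Matrix.one_apply]
    rw [hsub]
    simp [h0, hη]
  rw [formVol_submodule hrank _ hli h0, hval, abs_inv]

end DualForm

/-! ### Basis independence of the volume product -/

section VolumeProduct

universe u
variable {W : Type u} [NormedAddCommGroup W] [NormedSpace ℝ W] [FiniteDimensional ℝ W]

/-- A change of basis and the induced change of dual basis have inverse determinants. -/
theorem volumeProduct_eq {k : ℕ} (w : Basis (Fin k) ℝ W) :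
    volumeProduct W = coordVol w (Metric.closedBall (0 : W) 1) *
      coordVol w.dualBasis (polarBody (Metric.closedBall (0 : W) 1)) := by
  obtain rfl : k = finrank ℝ W := by simpa using (finrank_eq_card_basis w).symm
  have h1 : (finBasis ℝ W).dualBasis.det w.dualBasis = w.det (finBasis ℝ W) := by
    rw [Basis.det_apply, Basis.det_apply, ← Matrix.det_transpose]
    congr 1
    ext i j
    simp [Basis.toMatrix_apply, Basis.dualBasis_repr]
  rw [volumeProduct, coordVol_change (finBasis ℝ W) w, coordVol_change (finBasis ℝ W).dualBasis
    w.dualBasis, h1, mul_mul_mul_comm, ← abs_mul, Basis.det_mul_det, Basis.det_self, abs_one,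
    one_mul]

end VolumeProduct

/-! ### The radial function of the intersection body and the Holmes–Thompson density -/

section PolarSection

universe u
variable {V : Type u} [NormedAddCommGroup V] [NormedSpace ℝ V] [FiniteDimensional ℝ V] {m : ℕ}

/-- The volume of the section `B° ∩ p^⊥` of the polar of the unit ball. -/
def polarSection (Ω : V [⋀^Fin (m + 1)]→ₗ[ℝ] ℝ) (p : V) : ℝ :=
  formVol (restrictedForm (dualForm Ω) (Dual.eval ℝ V p))
    {η : LinearMap.ker (Dual.eval ℝ V p) | (η : Dual ℝ V) ∈ polarBody (Metric.closedBall (0 : V) 1)}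

/-- The ball is symmetric, so ξ ≤ 1 on it already means |ξ| ≤ 1. Polar sections thereby become
coordinate volumes of a norm ball, to which the continuity lemma applies. -/
theorem mem_polarBody_closedBall_iff (ξ : Dual ℝ V) :
    ξ ∈ polarBody (Metric.closedBall (0 : V) 1) ↔
      LinearMap.toContinuousLinearMap ξ ∈ Metric.closedBall (0 : V →L[ℝ] ℝ) 1 := by
  rw [mem_closedBall_zero_iff]
  constructor
  · intro h
    refine ContinuousLinearMap.opNorm_le_bound _ zero_le_one fun x => ?_
    by_cases hx : x = 0
    · simp [hx]
    have hn := norm_pos_iff.2 hx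
    have h1 := h (‖x‖⁻¹ • x) (by simp [norm_smul, hn.ne'])
    have h2 := h (-(‖x‖⁻¹ • x)) (by simp [norm_smul, hn.ne'])
    rw [map_neg, map_smul, smul_eq_mul] at h2
    rw [map_smul, smul_eq_mul, inv_mul_le_one₀ hn] at h1
    rw [← mul_neg, inv_mul_le_one₀ hn] at h2
    rw [one_mul, Real.norm_eq_abs, LinearMap.coe_toContinuousLinearMap']
    exact abs_le'.2 ⟨h1, h2⟩
  · intro h x hx
    have h1 := (LinearMap.toContinuousLinearMap ξ).le_of_opNorm_le h x
    rw [mem_closedBall_zero_iff] at hx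
    rw [one_mul, Real.norm_eq_abs, LinearMap.coe_toContinuousLinearMap'] at h1
    exact (le_abs_self _).trans (h1.trans hx)

theorem coordVol_polarBody (ξ : Fin m → Dual ℝ V) :
    coordVol ξ (polarBody (Metric.closedBall (0 : V) 1)) =
      coordVol (fun i => LinearMap.toContinuousLinearMap (ξ i))
        (Metric.closedBall (0 : V →L[ℝ] ℝ) 1) := by
  unfold coordVol
  congr 2
  ext y
  simp only [Set.mem_ofPred_eq, mem_polarBody_closedBall_iff, map_sum, map_smul]

variable (hV : finrank ℝ V = m + 1) {Ω : V [⋀^Fin (m + 1)]→ₗ[ℝ] ℝ} (hΩ : Ω ≠ 0)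
include hV hΩ

theorem polarSection_eq {p : V} {x : Fin m → V}
    (hx : Ω (Matrix.vecCons p x) ≠ 0) {ξ : Fin m → Dual ℝ V} (h0 : ∀ i, ξ i p = 0)
    (h1 : ∀ i j, ξ i (x j) = if i = j then 1 else 0) :
    polarSection Ω p = |Ω (Matrix.vecCons p x)|⁻¹ *
      coordVol (fun i => LinearMap.toContinuousLinearMap (ξ i))
        (Metric.closedBall (0 : V →L[ℝ] ℝ) 1) := by
  rw [polarSection, formVol_restrictedForm_dualForm hV hΩ hx h0 h1, coordVol_polarBody]

omit hV hΩ in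
theorem linearIndependent_toContinuousLinearMap {x : Fin m → V} {ξ : Fin m → Dual ℝ V}
    (h1 : ∀ i j, ξ i (x j) = if i = j then 1 else 0) :
    LinearIndependent ℝ fun i => LinearMap.toContinuousLinearMap (ξ i) := by
  rw [Fintype.linearIndependent_iff]
  intro g hg j
  have h2 := congrArg (fun η : V →L[ℝ] ℝ => η (x j)) hg
  simpa [h1] using h2

theorem exists_dual_family {p : V} (hp : p ≠ 0) : ∃ (x : Fin m → V) (ξ : Fin m → Dual ℝ V),
    Ω (Matrix.vecCons p x) ≠ 0 ∧ (∀ i, ξ i p = 0) ∧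
      ∀ i j, ξ i (x j) = if i = j then 1 else 0 := by
  obtain ⟨c, hc⟩ := exists_basis_zero_eq hV hp
  refine ⟨fun i => c i.succ, fun i => c.coord i.succ, ?_, fun i => ?_, fun i j => ?_⟩
  · rw [← basis_eq_vecCons c hc]
    exact apply_basis_ne_zero hΩ c
  · rw [← hc]
    simp
  · simp [Finsupp.single_apply, eq_comm]

theorem polarSection_pos {p : V} (hp : p ≠ 0) : 0 < polarSection Ω p := by
  obtain ⟨x, ξ, hx, h0, h1⟩ := exists_dual_family hV hΩ hp
  rw [polarSection_eq hV hΩ hx h0 h1]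
  exact mul_pos (inv_pos.2 (abs_pos.2 hx))
    (coordVol_closedBall_pos (linearIndependent_toContinuousLinearMap h1))

theorem polarSection_smul {r : ℝ} (hr : 0 < r) (p : V) :
    polarSection Ω (r • p) = r⁻¹ * polarSection Ω p := by
  -- At p = 0 no functional evaluates to 1, so the restricted form takes its default value 0 and
  -- both sides vanish.
  by_cases hp : p = 0
  · have : polarSection Ω (0 : V) = 0 := by
      unfold polarSection
      have h : restrictedForm (dualForm Ω) (Dual.eval ℝ V 0) = 0 := by
        rw [restrictedForm, dif_neg]
        simp
      rw [h, formVol, dif_neg]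
      simp
    rw [hp, smul_zero, this, mul_zero]
  obtain ⟨x, ξ, hx, h0, h1⟩ := exists_dual_family hV hΩ hp
  have hsm : Ω (Matrix.vecCons (r • p) x) = r * Ω (Matrix.vecCons p x) := by
    rw [← AlternatingMap.curryLeft_apply_apply, map_smul]
    rfl
  rw [polarSection_eq hV hΩ hx h0 h1, polarSection_eq hV hΩ (x := x) (ξ := ξ)
    (by rw [hsm]; exact mul_ne_zero hr.ne' hx) (fun i => by rw [map_smul, h0, smul_zero]) h1, hsm,
    abs_mul, abs_of_pos hr, mul_inv, mul_assoc]

theorem continuousAt_polarSection {p₀ : V} (hp : p₀ ≠ 0) : ContinuousAt (polarSection Ω) p₀ := by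
  obtain ⟨c, hc⟩ := exists_basis_zero_eq hV hp
  -- Correcting the i-th coordinate by a multiple of the zeroth makes it vanish at p without
  -- changing its values on the fixed c_1, …, c_m. The family varies continuously where the zeroth
  -- coordinate of p is nonzero, in particular near p₀ = c_0.
  let ξ : V → Fin m → Dual ℝ V := fun p i =>
    c.coord i.succ - (c.coord i.succ p / c.coord 0 p) • c.coord 0
  have hcoord : ∀ j, Continuous (c.coord j) := fun j => LinearMap.continuous_of_finiteDimensional _
  have h00 : c.coord 0 p₀ = 1 := by simp [← hc]
  have hev : ∀ᶠ p in nhds p₀, c.coord 0 p ≠ 0 :=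
    (hcoord 0).continuousAt.eventually_ne (by rw [h00]; exact one_ne_zero)
  have h1 : ∀ p i j, ξ p i (c (Fin.succ j)) = if i = j then 1 else 0 := fun p i j => by
    simp [ξ, Finsupp.single_apply, eq_comm]
  have h0 : ∀ p, c.coord 0 p ≠ 0 → ∀ i, ξ p i p = 0 := fun p hp0 i => by
    simp only [ξ, LinearMap.sub_apply, LinearMap.smul_apply, smul_eq_mul]
    field_simp
    simp
  have hΩp : ∀ p, Ω (Matrix.vecCons p fun i => c i.succ) = c.coord 0 p * Ω c := fun p => by
    let f : V →ₗ[ℝ] ℝ :=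
      { toFun := fun p => Ω.curryLeft p fun i => c i.succ
        map_add' := fun p q => by rw [map_add, AlternatingMap.add_apply]
        map_smul' := fun r p => by rw [map_smul, AlternatingMap.smul_apply, RingHom.id_apply] }
    have hf : f = Ω c • c.coord 0 := by
      refine c.ext fun j => Fin.cases ?_ (fun i => ?_) j
      · change Ω (Matrix.vecCons (c 0) fun i => c i.succ) = _
        rw [← basis_eq_vecCons c rfl]
        simp
      · change Ω (Matrix.vecCons (c i.succ) fun i => c i.succ) = _
        rw [Ω.map_eq_zero_of_eq _ (i := 0) (j := i.succ) (by simp) (Fin.succ_ne_zero i).symm]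
        simp
    have := LinearMap.congr_fun hf p
    rwa [LinearMap.smul_apply, smul_eq_mul, mul_comm] at this
  have heq : polarSection Ω =ᶠ[nhds p₀] fun p => |c.coord 0 p * Ω c|⁻¹ *
      coordVol (fun i => LinearMap.toContinuousLinearMap (ξ p i))
        (Metric.closedBall (0 : V →L[ℝ] ℝ) 1) := by
    filter_upwards [hev] with p hp0
    rw [← hΩp, polarSection_eq hV hΩ (x := fun i => c i.succ) (ξ := ξ p)
      (by rw [hΩp]; exact mul_ne_zero hp0 (apply_basis_ne_zero hΩ c)) (h0 p hp0) (h1 p)]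
  refine ContinuousAt.congr ?_ heq.symm
  refine ContinuousAt.mul ?_ (continuousAt_coordVol_closedBall ?_
    (linearIndependent_toContinuousLinearMap (h1 p₀)))
  · refine ContinuousAt.inv₀ ((hcoord 0).continuousAt.mul continuousAt_const).abs ?_
    rw [h00, one_mul]
    exact abs_ne_zero.2 (apply_basis_ne_zero hΩ c)
  · refine continuousAt_pi.2 fun i => ?_
    simp only [ξ, map_sub, map_smul]
    refine continuousAt_const.sub (ContinuousAt.fun_smul ?_ continuousAt_const)
    exact (hcoord _).continuousAt.div (hcoord 0).continuousAt (by rw [h00]; exact one_ne_zero)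

theorem isRadial_polarSection : IsRadial (polarSection Ω) where
  pos _ hp := polarSection_pos hV hΩ hp
  smul _ hr _ := polarSection_smul hV hΩ hr _
  continuousOn _ hp := (continuousAt_polarSection hV hΩ hp).continuousWithinAt

omit hV hΩ in
theorem intersectionBodyOfPolar_closedBall :
    intersectionBodyOfPolar Ω (Metric.closedBall (0 : V) 1) = starSet (polarSection Ω) := by
  ext x
  simp only [intersectionBodyOfPolar, intersectionBody, Set.mem_preimage, Set.mem_ofPred_eq,
    starSet, Module.eval_apply_eq_zero_iff]
  rfl

/-- Composition with the projection identifies the functionals on V/⟨p⟩ with those on V that kill p,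
and the polar of the quotient ball with B° ∩ p^⊥. The volume of the quotient ball cancels against
`shadow`. -/
theorem volumeProduct_quotient {p : V} (hp : p ≠ 0) :
    volumeProduct (V ⧸ Submodule.span ℝ {p}) * (shadow Ω p)⁻¹ = polarSection Ω p := by
  obtain ⟨x, hx⟩ := exists_apply_vecCons_ne_zero hV hΩ hp
  have hli := (linearIndependent_mkQ_iff hV hΩ hp x).2 hx
  obtain ⟨q, hq⟩ := exists_basis_coe_eq hli (by simp [finrank_quotient_line hV hp])
  have hball := coordVol_closedBall_pos hli
  have hxq : ∀ i, (Submodule.span ℝ {p}).mkQ (x i) = q i := fun i => (congrFun hq i).symm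
  rw [volumeProduct_eq q, shadow, formVol_contraction hV hΩ hp hx, mkQ_image_closedBall, ← hq,
    polarSection, formVol_restrictedForm_dualForm hV hΩ hx
      (ξ := fun i => (q.dualBasis i).comp (Submodule.span ℝ {p}).mkQ)]
  · have hvol : coordVol (fun i => (q.dualBasis i).comp (Submodule.span ℝ {p}).mkQ)
        (polarBody (Metric.closedBall (0 : V) 1)) =
        coordVol q.dualBasis (polarBody (Metric.closedBall (0 : V ⧸ Submodule.span ℝ {p}) 1)) := by
      unfold coordVol
      congr 2
      ext y
      rw [← mkQ_image_closedBall]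
      simp [polarBody]
    rw [← hq] at hball
    rw [hvol]
    have := abs_pos.2 hx
    field_simp
  · intro i
    have : (Submodule.span ℝ {p}).mkQ p = 0 := by simp [Submodule.mem_span_singleton_self]
    rw [LinearMap.comp_apply, this, map_zero]
  · intro i j
    rw [LinearMap.comp_apply, hxq, Basis.dualBasis_apply_self]
    simp [eq_comm]

theorem quotientDensity_holmesThompson {p : V} (hp : p ≠ 0) (v : Fin m → V) :
    quotientDensity holmesThompson p v =
      1 / ballVol m * polarSection Ω p * |Ω (Matrix.vecCons p v)| := by
  rw [quotientDensity, holmesThompson, normWithBallVolume_mkQ hV hΩ hp,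
    ← volumeProduct_quotient hV hΩ hp, finrank_quotient_line hV hp]
  ring

end PolarSection

end DualIso

end

theorem mainTheorem2 {V : Type*} [NormedAddCommGroup V] [NormedSpace ℝ V] [FiniteDimensional ℝ V]
    (m : ℕ) (hV : Module.finrank ℝ V = m + 1)
    (Ω : V [⋀^Fin (m + 1)]→ₗ[ℝ] ℝ) (hΩ : Ω ≠ 0) :
    (DualIso.IsDualIsoperimetrix DualIso.busemann Ω
        (DualIso.ballVol m • DualIso.polarProjectionBody Ω (Metric.closedBall (0 : V) 1)) ∧
      (1 ≤ m → ∀ T : Set V, DualIso.IsDualIsoperimetrix DualIso.busemann Ω T →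
        T = DualIso.ballVol m • DualIso.polarProjectionBody Ω (Metric.closedBall (0 : V) 1))) ∧
    (DualIso.IsDualIsoperimetrix DualIso.holmesThompson Ω
        ((1 / DualIso.ballVol m) •
          DualIso.intersectionBodyOfPolar Ω (Metric.closedBall (0 : V) 1)) ∧
      (1 ≤ m → ∀ T : Set V, DualIso.IsDualIsoperimetrix DualIso.holmesThompson Ω T →
        T = (1 / DualIso.ballVol m) •
          DualIso.intersectionBodyOfPolar Ω (Metric.closedBall (0 : V) 1))) := by
  have hb := DualIso.ballVol_pos m
  have hs := DualIso.isRadial_shadow_inv hV hΩ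
  have hp := DualIso.isRadial_polarSection hV hΩ
  rw [DualIso.polarProjectionBody_closedBall hV hΩ, DualIso.intersectionBodyOfPolar_closedBall,
    DualIso.smul_starSet hs hb, DualIso.smul_starSet hp (one_div_pos.2 hb)]
  have hqb := fun p (h : p ≠ 0) => DualIso.quotientDensity_busemann hV hΩ h
  have hqh := fun p (h : p ≠ 0) => DualIso.quotientDensity_holmesThompson hV hΩ h
  have hgb := hs.smul_const hb
  have hgh := hp.smul_const (one_div_pos.2 hb)
  exact ⟨⟨DualIso.isDualIsoperimetrix_starSet hV hΩ hgb hqb,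
      fun hm _ hT => hT.eq_starSet hV hΩ hgb hqb hm⟩,
    DualIso.isDualIsoperimetrix_starSet hV hΩ hgh hqh,
    fun hm _ hT => hT.eq_starSet hV hΩ hgh hqh hm⟩
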